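/- Let $B$ be a ring (associative, with unit, not necessarily commutative), $w\in B$ a central element, $A=B/(w)$, and $\nu\colon B\to B$ a ring automorphism with $\nu(bw)=bw$ for all $b\in B$; write $\nu$ also for the induced automorphism of $A$. For a left module $M$ over $B$ (or $A$) and $n\in\mathbb Z$ let ${}_{\nu^n}M$ be $M$ with $b$ acting as $\nu^n(b)$. Let $S_\nu$ be the functor $M\mapsto{}_{\nu}M$ (the identity on maps) and $\eta_w\colon 1\to S_\nu$ the natural transformation $M\to{}_\nu M$, $m\mapsto wm$. Let $\mathscr C$ be either the category $\operatorname{Mod} B$ of left $B$-modules or the category $\mathscr F(B)$ of finitely generated free left $B$-modules, with the restrictions of $S_\nu$ and $\eta_w$. A $(\mathscr C,S_\nu)$-factorization $(M,N,f,g)$ of $\eta_w$ consists of maps $M\xrightarrow{f}N\xrightarrow{g}S_\nu M$ in $\mathscr C$ with $g\circ f=\eta_M$ and $(S_\nu f)\circ g=\eta_N$. A morphism $(M_1,N_1,f_1,g_1)\to(M_2,N_2,f_2,g_2)$ is a pair $\psi\colon M_1\to M_2$, $\phi\colon N_1\to N_2$ with $\phi f_1=f_2\psi$ and $(S_\nu\psi)g_1=g_2\phi$.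 Morphisms $(\psi,\phi)$ and $(\psi',\phi')$ are homotopic if there are $s\colon N_1\to M_2$ and $t\colon S_\nu M_1\to N_2$ with $\psi-\psi'=sf_1+S_\nu^{-1}(g_2t)$ and $\phi-\phi'=tg_1+f_2s$. The homotopy category $\mathbf{HFact}(\mathscr C,S_\nu,\eta_w)$ has the factorizations as objects and homotopy classes of morphisms as morphisms. Its suspension is $\Sigma(M,N,f,g)=(N,S_\nu M,-g,-S_\nu f)$, $\Sigma[(\psi,\phi)]=[(\phi,S_\nu\psi)]$. The mapping cone $C_\theta$ of $\theta=(\psi,\phi)$ is $$N_1\oplus M_2\xrightarrow{\left(\begin{smallmatrix}-g_1&0\\ \phi&f_2\end{smallmatrix}\right)}S_\nu M_1\oplus N_2\xrightarrow{\left(\begin{smallmatrix}-S_\nu f_1&0\\ S_\nu\psi&g_2\end{smallmatrix}\right)}S_\nu N_1\oplus S_\nu M_2,$$ and the distinguished triangles are those isomorphic in the homotopy category to a triangle $X\xrightarrow{[\theta]}Y\to C_\theta\to\Sigma X$ given by a morphism of factorizations $\theta\colon X\to Y$ and the canonical inclusion and projection. For an additive category $\mathscr D$ let $\mathbf K(\mathscr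 D)$ be the homotopy category of complexes in $\mathscr D$ with its usual suspension and distinguished triangles. A triangle functor is an additive functor $T$, admitting a natural isomorphism $T\Sigma\cong\Sigma T$ by means of which it sends distinguished triangles to distinguished triangles. Then reduction modulo $w$ induces a triangle functor $$\mathbf{HFact}(\operatorname{Mod}B,S_\nu,\eta_w)\longrightarrow\mathbf K(\operatorname{Mod}A).$$ It sends a factorization $(M,N,f,g)$ to the complex $$\cdots\to{}_{\nu^{n-1}}(N/wN)\xrightarrow{\overline g}{}_{\nu^n}(M/wM)\xrightarrow{\overline f}{}_{\nu^n}(N/wN)\xrightarrow{\overline g}{}_{\nu^{n+1}}(M/wM)\to\cdots$$ of left $A$-modules, with $M/wM$ in degree zero, and the class of a morphism $(\psi,\phi)$ to the class of the chain map with components $\overline\psi$ and $\overline\phi$. The same formulas give a triangle functor $$\mathbf{HFact}(\mathscr F(B),S_\nu,\eta_w)\longrightarrow\mathbf K(\mathscr F(A)).$$ -/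

import Mathlib

open CategoryTheory CategoryTheory.Limits

universe v v' u u'

namespace TwFact

/-! ### Factorizations of a central element in a suspended additive category -/

section General

variable {C : Type u} [Category.{v} C]

/-- A central element of the suspended category `(C, S)`: a natural transformation `η : 1 ⟶ S`
with `η_{S M} = S η_M` for all `M`. -/
structure CentralElement (S : C ⥤ C) where
  η : 𝟭 C ⟶ S
  app_obj : ∀ M : C, η.app (S.obj M) = S.map (η.app M)

variable {S : C ⥤ C}

lemma CentralElement.naturality (z : CentralElement S) {X Y : C} (h : X ⟶ Y) :
    h ≫ z.η.app Y = z.η.app X ≫ S.map h := z.η.naturality h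

/-- A `(C, S)`-factorization `M --f--> N --g--> S M` of a central element. -/
structure Fact (z : CentralElement S) where
  M : C
  N : C
  f : M ⟶ N
  g : N ⟶ S.obj M
  f_g : f ≫ g = z.η.app M
  g_f : g ≫ S.map f = z.η.app N

variable {z : CentralElement S}

/-- A morphism of factorizations: a pair `(ψ, φ)` making the two squares commute. -/
@[ext]
structure Fact.Hom (X Y : Fact z) where
  ψ : X.M ⟶ Y.M
  φ : X.N ⟶ Y.N
  comm_f : X.f ≫ φ = ψ ≫ Y.f
  comm_g : X.g ≫ S.map ψ = φ ≫ Y.g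

instance : Category (Fact z) where
  Hom := Fact.Hom
  id X := ⟨𝟙 _, 𝟙 _, by simp, by simp⟩
  comp a b := ⟨a.ψ ≫ b.ψ, a.φ ≫ b.φ,
    by rw [← Category.assoc, a.comm_f, Category.assoc, b.comm_f, Category.assoc],
    by rw [S.map_comp, ← Category.assoc, a.comm_g, Category.assoc, b.comm_g, Category.assoc]⟩

@[ext]
lemma Fact.hom_ext {X Y : Fact z} {a b : X ⟶ Y} (h₁ : a.ψ = b.ψ) (h₂ : a.φ = b.φ) : a = b :=
  Fact.Hom.ext h₁ h₂

@[simp] lemma Fact.id_ψ (X : Fact z) : Fact.Hom.ψ (𝟙 X) = 𝟙 X.M := rfl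
@[simp] lemma Fact.id_φ (X : Fact z) : Fact.Hom.φ (𝟙 X) = 𝟙 X.N := rfl
@[simp] lemma Fact.comp_ψ {X Y Z : Fact z} (a : X ⟶ Y) (b : Y ⟶ Z) :
    (a ≫ b).ψ = a.ψ ≫ b.ψ := rfl
@[simp] lemma Fact.comp_φ {X Y Z : Fact z} (a : X ⟶ Y) (b : Y ⟶ Z) :
    (a ≫ b).φ = a.φ ≫ b.φ := rfl

variable [Preadditive C] [S.Additive]

namespace Fact

instance (X Y : Fact z) : Zero (X ⟶ Y) := ⟨⟨0, 0, by simp, by simp⟩⟩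
instance (X Y : Fact z) : Add (X ⟶ Y) := ⟨fun a b => ⟨a.ψ + b.ψ, a.φ + b.φ,
  by simp [a.comm_f, b.comm_f], by simp [a.comm_g, b.comm_g, S.map_add]⟩⟩
instance (X Y : Fact z) : Neg (X ⟶ Y) := ⟨fun a => ⟨-a.ψ, -a.φ,
  by simp [a.comm_f], by simp [a.comm_g, S.map_neg]⟩⟩

@[simp] lemma zero_ψ (X Y : Fact z) : Fact.Hom.ψ (0 : X ⟶ Y) = 0 := rfl
@[simp] lemma zero_φ (X Y : Fact z) : Fact.Hom.φ (0 : X ⟶ Y) = 0 := rfl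
@[simp] lemma add_ψ {X Y : Fact z} (a b : X ⟶ Y) : (a + b).ψ = a.ψ + b.ψ := rfl
@[simp] lemma add_φ {X Y : Fact z} (a b : X ⟶ Y) : (a + b).φ = a.φ + b.φ := rfl
@[simp] lemma neg_ψ {X Y : Fact z} (a : X ⟶ Y) : (-a).ψ = -a.ψ := rfl
@[simp] lemma neg_φ {X Y : Fact z} (a : X ⟶ Y) : (-a).φ = -a.φ := rfl

/-- Morphisms of factorizations are added componentwise. -/
instance : Preadditive (Fact z) where
  homGroup X Y :=
    { add_assoc := fun a b c => by ext <;> simp [add_assoc]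
      zero_add := fun a => by ext <;> simp
      add_zero := fun a => by ext <;> simp
      add_comm := fun a b => by ext <;> simp [add_comm]
      neg_add_cancel := fun a => by ext <;> simp
      nsmul := nsmulRec
      zsmul := zsmulRec }
  add_comp := by intros; ext <;> simp
  comp_add := by intros; ext <;> simp

/-- Two morphisms `(ψ, φ)` and `(ψ', φ')` of factorizations are homotopic if there are
`s : N₁ ⟶ M₂` and `t : S M₁ ⟶ N₂` with `ψ - ψ' = s ∘ f₁ + S⁻¹ (g₂ ∘ t)` and
`φ - φ' = t ∘ g₁ + f₂ ∘ s`. The first equation is written after applying the automorphism `S`. -/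
def Homotopic (z : CentralElement S) : HomRel (Fact z) := fun X Y θ θ' =>
  ∃ (s : X.N ⟶ Y.M) (t : S.obj X.M ⟶ Y.N),
    S.map (θ.ψ - θ'.ψ) = S.map (X.f ≫ s) + t ≫ Y.g ∧
    θ.φ - θ'.φ = X.g ≫ t + s ≫ Y.f

instance : Congruence (Homotopic z) where
  equivalence :=
    { refl := fun θ => ⟨0, 0, by simp, by simp⟩
      symm := by
        rintro a b ⟨s, t, h₁, h₂⟩
        refine ⟨-s, -t, ?_, ?_⟩
        · rw [← neg_sub, S.map_neg, h₁]; simp [S.map_neg]; abel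
        · rw [← neg_sub, h₂]; simp; abel
      trans := by
        rintro a b c ⟨s, t, h₁, h₂⟩ ⟨s', t', h₁', h₂'⟩
        refine ⟨s + s', t + t', ?_, ?_⟩
        · rw [← sub_add_sub_cancel _ b.ψ, S.map_add, h₁, h₁']; simp [S.map_add]; abel
        · rw [← sub_add_sub_cancel _ b.φ, h₂, h₂']; simp; abel }
  comp_left := by
    rintro X Y Z a b b' ⟨s, t, h₁, h₂⟩
    refine ⟨a.φ ≫ s, S.map a.ψ ≫ t, ?_, ?_⟩
    · have e : (a ≫ b).ψ - (a ≫ b').ψ = a.ψ ≫ (b.ψ - b'.ψ) := by simp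
      rw [e, S.map_comp, h₁, Preadditive.comp_add, ← S.map_comp, ← Category.assoc, ← a.comm_f,
        Category.assoc, Category.assoc]
    · have e : (a ≫ b).φ - (a ≫ b').φ = a.φ ≫ (b.φ - b'.φ) := by simp
      rw [e, h₂, Preadditive.comp_add, ← Category.assoc, ← a.comm_g, Category.assoc,
        Category.assoc]
  comp_right := by
    rintro X Y Z b b' a ⟨s, t, h₁, h₂⟩
    refine ⟨s ≫ a.ψ, t ≫ a.φ, ?_, ?_⟩
    · have e : (b ≫ a).ψ - (b' ≫ a).ψ = (b.ψ - b'.ψ) ≫ a.ψ := by simp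
      rw [e, S.map_comp, h₁, Preadditive.add_comp, ← S.map_comp, Category.assoc, Category.assoc,
        Category.assoc, a.comm_g]
    · have e : (b ≫ a).φ - (b' ≫ a).φ = (b.φ - b'.φ) ≫ a.φ := by simp
      rw [e, h₂, Preadditive.add_comp, Category.assoc, Category.assoc, Category.assoc, a.comm_f]

lemma homotopic_add ⦃X Y : Fact z⦄ (a b a' b' : X ⟶ Y) (h : Homotopic z a b)
    (h' : Homotopic z a' b') : Homotopic z (a + a') (b + b') := by
  obtain ⟨s, t, h₁, h₂⟩ := h
  obtain ⟨s', t', h₁', h₂'⟩ := h'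
  refine ⟨s + s', t + t', ?_, ?_⟩
  · rw [add_ψ, add_ψ, add_sub_add_comm, S.map_add, h₁, h₁']; simp [S.map_add]; abel
  · rw [add_φ, add_φ, add_sub_add_comm, h₂, h₂']; simp; abel

end Fact

/-- The homotopy category of factorizations. -/
abbrev HFact (z : CentralElement S) := CategoryTheory.Quotient (Fact.Homotopic z)

/-- The functor from factorizations to the homotopy category. -/
abbrev HFact.quotient (z : CentralElement S) : Fact z ⥤ HFact z :=
  CategoryTheory.Quotient.functor (Fact.Homotopic z)

instance : Preadditive (HFact z) := CategoryTheory.Quotient.preadditive _ Fact.homotopic_add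

namespace Fact

/-- The suspension `Σ (M, N, f, g) = (N, S M, -g, -S f)` on factorizations; it sends `(ψ, φ)` to
`(φ, S ψ)`. -/
@[simps]
def suspension (z : CentralElement S) : Fact z ⥤ Fact z where
  obj X :=
    { M := X.N
      N := S.obj X.M
      f := -X.g
      g := -S.map X.f
      f_g := by simp [X.g_f]
      g_f := by
        rw [S.map_neg, Preadditive.neg_comp_neg, ← S.map_comp, X.f_g, z.app_obj] }
  map {X Y} a :=
    { ψ := a.φ
      φ := S.map a.ψ
      comm_f := by simp [a.comm_g]
      comm_g := by
        have h : (-S.map X.f) ≫ S.map a.φ = S.map a.ψ ≫ (-S.map Y.f) := by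
          rw [Preadditive.neg_comp (S.map X.f), Preadditive.comp_neg (S.map a.ψ), ← S.map_comp,
            ← S.map_comp, a.comm_f]
        exact h }

lemma homotopic_suspension {X Y : Fact z} (a b : X ⟶ Y) (h : Homotopic z a b) :
    Homotopic z ((suspension z).map a) ((suspension z).map b) := by
  obtain ⟨s, t, h₁, h₂⟩ := h
  refine ⟨-t, -S.map s, ?_, ?_⟩
  · change S.map (a.φ - b.φ) = S.map ((-X.g) ≫ (-t)) + (-S.map s) ≫ (-S.map Y.f)
    rw [h₂, S.map_add, Preadditive.neg_comp_neg, Preadditive.neg_comp_neg, S.map_comp s]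
  · change S.map a.ψ - S.map b.ψ = (-S.map X.f) ≫ (-S.map s) + (-t) ≫ (-Y.g)
    rw [← S.map_sub, h₁, Preadditive.neg_comp_neg, Preadditive.neg_comp_neg, S.map_comp]

variable [HasBinaryBiproducts C]

/-- The mapping cone of a morphism `(ψ, φ)`: the factorization
`N₁ ⊞ M₂ ⟶ S M₁ ⊞ N₂ ⟶ S (N₁ ⊞ M₂) = S N₁ ⊞ S M₂` with matrices `(-g₁, 0; φ, f₂)` and
`(-S f₁, 0; S ψ, g₂)`. -/
@[simps]
noncomputable def cone {X Y : Fact z} (θ : X ⟶ Y) : Fact z where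
  M := X.N ⊞ Y.M
  N := S.obj X.M ⊞ Y.N
  f := biprod.desc (biprod.lift (-X.g) θ.φ) (biprod.lift 0 Y.f)
  g := biprod.desc
    (-S.map X.f ≫ S.map biprod.inl + S.map θ.ψ ≫ S.map biprod.inr)
    (Y.g ≫ S.map biprod.inr)
  f_g := by
    apply biprod.hom_ext'
    · rw [biprod.inl_desc_assoc, biprod.lift_desc, z.naturality, ← X.g_f, ← Category.assoc θ.φ,
        ← θ.comm_g]
      simp
    · rw [biprod.inr_desc_assoc, biprod.lift_desc, z.naturality, ← Y.f_g]
      simp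
  g_f := by
    apply biprod.hom_ext'
    · rw [biprod.inl_desc_assoc, z.naturality, z.app_obj, ← X.f_g, Preadditive.add_comp]
      simp only [Preadditive.neg_comp, Category.assoc, ← S.map_comp, biprod.inl_desc,
        biprod.inr_desc]
      rw [← S.map_neg, ← S.map_add]
      congr 1
      ext <;> simp [θ.comm_f]
    · rw [biprod.inr_desc_assoc, z.naturality, ← Y.g_f, Category.assoc, Category.assoc,
        ← S.map_comp, biprod.inr_desc, ← S.map_comp]
      congr 2
      ext <;> simp

/-- The inclusion `i_θ` into the mapping cone. -/
@[simps]
noncomputable def coneι {X Y : Fact z} (θ : X ⟶ Y) : Y ⟶ cone θ where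
  ψ := biprod.inr
  φ := biprod.inr
  comm_f := by
    have h : Y.f ≫ (biprod.inr : _ ⟶ S.obj X.M ⊞ Y.N) = (biprod.inr : _ ⟶ X.N ⊞ Y.M) ≫
        biprod.desc (biprod.lift (-X.g) θ.φ) (biprod.lift 0 Y.f) := by
      apply biprod.hom_ext <;> simp
    exact h
  comm_g := by
    have h : Y.g ≫ S.map (biprod.inr : _ ⟶ X.N ⊞ Y.M) =
        (biprod.inr : _ ⟶ S.obj X.M ⊞ Y.N) ≫ biprod.desc
          (-S.map X.f ≫ S.map biprod.inl + S.map θ.ψ ≫ S.map biprod.inr)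
          (Y.g ≫ S.map biprod.inr) := by
      rw [biprod.inr_desc]
    exact h

/-- The projection `π_θ` from the mapping cone to the suspension. -/
@[simps]
noncomputable def coneπ {X Y : Fact z} (θ : X ⟶ Y) : cone θ ⟶ (suspension z).obj X where
  ψ := biprod.fst
  φ := biprod.fst
  comm_f := by
    have h : biprod.desc (biprod.lift (-X.g) θ.φ) (biprod.lift 0 Y.f) ≫
        (biprod.fst : S.obj X.M ⊞ Y.N ⟶ _) = biprod.fst ≫ (-X.g) := by
      apply biprod.hom_ext' <;> simp
    exact h
  comm_g := by
    have h : biprod.desc (-S.map X.f ≫ S.map biprod.inl + S.map θ.ψ ≫ S.map biprod.inr)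
        (Y.g ≫ S.map biprod.inr) ≫ S.map (biprod.fst : X.N ⊞ Y.M ⟶ _) =
        biprod.fst ≫ (-S.map X.f) := by
      apply biprod.hom_ext'
      · rw [biprod.inl_desc_assoc, Preadditive.add_comp, Preadditive.neg_comp, Category.assoc,
          Category.assoc, ← S.map_comp, ← S.map_comp biprod.inr, biprod.inr_fst]
        simp
      · rw [biprod.inr_desc_assoc, Category.assoc, ← S.map_comp]
        simp
    exact h

end Fact

/-- The suspension on the homotopy category of factorizations. -/
def HFact.suspension (z : CentralElement S) : HFact z ⥤ HFact z :=
  CategoryTheory.Quotient.lift _ (Fact.suspension z ⋙ HFact.quotient z)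
    (fun _ _ _ _ h => CategoryTheory.Quotient.sound _ (Fact.homotopic_suspension _ _ h))

end General

/-! ### Triangles and triangle functors -/

section Triangles

/-- A triangle `X₁ ⟶ X₂ ⟶ X₃ ⟶ Σ X₁` in a category with a suspension functor `Σ = E`. -/
structure Tri {T : Type u} [Category.{v} T] (E : T ⥤ T) where
  {obj₁ obj₂ obj₃ : T}
  mor₁ : obj₁ ⟶ obj₂
  mor₂ : obj₂ ⟶ obj₃
  mor₃ : obj₃ ⟶ E.obj obj₁

variable {T : Type u} [Category.{v} T] {E : T ⥤ T}
  {T' : Type u'} [Category.{v'} T'] {E' : T' ⥤ T'}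

/-- Isomorphism of triangles. -/
def Tri.Isomorphic (X Y : Tri E) : Prop :=
  ∃ (e₁ : X.obj₁ ≅ Y.obj₁) (e₂ : X.obj₂ ≅ Y.obj₂) (e₃ : X.obj₃ ≅ Y.obj₃),
    X.mor₁ ≫ e₂.hom = e₁.hom ≫ Y.mor₁ ∧
    X.mor₂ ≫ e₃.hom = e₂.hom ≫ Y.mor₂ ∧
    X.mor₃ ≫ E.map e₁.hom = e₃.hom ≫ Y.mor₃

/-- The image of a triangle under a functor `F` with an isomorphism `ξ : F Σ ≅ Σ' F`. -/
@[simps]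
def Tri.map (F : T ⥤ T') (ξ : E ⋙ F ≅ F ⋙ E') (X : Tri E) : Tri E' where
  mor₁ := F.map X.mor₁
  mor₂ := F.map X.mor₂
  mor₃ := F.map X.mor₃ ≫ ξ.hom.app X.obj₁

/-- `F` is a triangle functor `(T, Σ, Δ) ⟶ (T', Σ', Δ')`: it is additive and admits a natural
isomorphism `F Σ ≅ Σ' F` for which it sends the triangles in `Δ` to triangles in `Δ'`. -/
def IsTriangleFunctor [Preadditive T] [Preadditive T'] (Δ : Set (Tri E)) (Δ' : Set (Tri E'))
    (F : T ⥤ T') : Prop :=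
  F.Additive ∧ ∃ ξ : E ⋙ F ≅ F ⋙ E', ∀ X ∈ Δ, X.map F ξ ∈ Δ'

/-- The standard triangle `X ⟶ Y ⟶ C_θ ⟶ Σ X` of a morphism of factorizations. -/
noncomputable def HFact.standardTriangle {C : Type u} [Category.{v} C] [Preadditive C]
    [HasBinaryBiproducts C] {S : C ⥤ C} [S.Additive] {z : CentralElement S} {X Y : Fact z}
    (θ : X ⟶ Y) : Tri (HFact.suspension z) where
  obj₁ := (HFact.quotient z).obj X
  obj₂ := (HFact.quotient z).obj Y
  obj₃ := (HFact.quotient z).obj (Fact.cone θ)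
  mor₁ := (HFact.quotient z).map θ
  mor₂ := (HFact.quotient z).map (Fact.coneι θ)
  mor₃ := (HFact.quotient z).map (Fact.coneπ θ)

/-- The distinguished triangles of the homotopy category of factorizations: those that are
isomorphic to a standard triangle. -/
def HFact.distinguished {C : Type u} [Category.{v} C] [Preadditive C]
    [HasBinaryBiproducts C] {S : C ⥤ C} [S.Additive] (z : CentralElement S) :
    Set (Tri (HFact.suspension z)) :=
  {X | ∃ (Y₁ Y₂ : Fact z) (θ : Y₁ ⟶ Y₂), X.Isomorphic (HFact.standardTriangle θ)}

/-- The homotopy category `K(D)` of (cochain) complexes in `D`. -/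
abbrev KCat (D : Type u) [Category.{v} D] [Preadditive D] :=
  HomotopyCategory D (ComplexShape.up ℤ)

/-- The distinguished triangles of `K(D)`, as in Mathlib. -/
def KCat.distinguished (D : Type u) [Category.{v} D] [Preadditive D] [HasZeroObject D]
    [HasBinaryBiproducts D] : Set (Tri (shiftFunctor (KCat D) (1 : ℤ))) :=
  {X | Pretriangulated.Triangle.mk X.mor₁ X.mor₂ X.mor₃ ∈
    Pretriangulated.distinguishedTriangles (C := KCat D)}

end Triangles

/-! ### Interleaved complexes -/

section Interleave

variable {D : Type u}

/-- The sequence with `P n` in degree `2 n` and `Q n` in degree `2 n + 1`. -/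
def interleaveX (P Q : ℤ → D) (i : ℤ) : D := if Even i then P (i / 2) else Q (i / 2)

lemma interleaveX_even (P Q : ℤ → D) {i n : ℤ} (h : i = 2 * n) : interleaveX P Q i = P n := by
  subst h; simp [interleaveX]

lemma interleaveX_odd (P Q : ℤ → D) {i n : ℤ} (h : i = 2 * n + 1) :
    interleaveX P Q i = Q n := by
  subst h
  have : ¬ Even (2 * n + 1) := by simp
  rw [interleaveX, if_neg this]
  congr 1
  lia

variable [Category.{v} D]

lemma eq_two_mul_of_even {i : ℤ} (h : Even i) : i = 2 * (i / 2) := by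
  obtain ⟨k, rfl⟩ := h; lia

lemma eq_two_mul_add_one_of_not_even {i : ℤ} (h : ¬ Even i) : i = 2 * (i / 2) + 1 := by
  obtain ⟨k, rfl⟩ := Int.not_even_iff_odd.1 h; lia

/-- The sequence of maps `⋯ ⟶ P n --α n--> Q n --β n--> P (n + 1) ⟶ ⋯`, up to the identifications
of the terms. -/
def interleaveD {P Q : ℤ → D} (α : ∀ n, P n ⟶ Q n) (β : ∀ n, Q n ⟶ P (n + 1)) (i : ℤ) :
    interleaveX P Q i ⟶ interleaveX P Q (i + 1) :=
  if h : Even i then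
    eqToHom (interleaveX_even P Q (eq_two_mul_of_even h)) ≫ α (i / 2) ≫
      eqToHom (interleaveX_odd P Q (by have := eq_two_mul_of_even h; lia)).symm
  else
    eqToHom (interleaveX_odd P Q (eq_two_mul_add_one_of_not_even h)) ≫ β (i / 2) ≫
      eqToHom (interleaveX_even P Q (by have := eq_two_mul_add_one_of_not_even h; lia)).symm

/-- The sequence of maps with `a n` in degree `2 n` and `b n` in degree `2 n + 1`. -/
def interleaveMap {P Q P' Q' : ℤ → D} (a : ∀ n, P n ⟶ P' n) (b : ∀ n, Q n ⟶ Q' n) (i : ℤ) :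
    interleaveX P Q i ⟶ interleaveX P' Q' i :=
  if h : Even i then
    eqToHom (interleaveX_even P Q (eq_two_mul_of_even h)) ≫ a (i / 2) ≫
      eqToHom (interleaveX_even P' Q' (eq_two_mul_of_even h)).symm
  else
    eqToHom (interleaveX_odd P Q (eq_two_mul_add_one_of_not_even h)) ≫ b (i / 2) ≫
      eqToHom (interleaveX_odd P' Q' (eq_two_mul_add_one_of_not_even h)).symm

section
variable {P Q P' Q' P'' Q'' : ℤ → D} (α : ∀ n, P n ⟶ Q n) (β : ∀ n, Q n ⟶ P (n + 1))
  (α' : ∀ n, P' n ⟶ Q' n) (β' : ∀ n, Q' n ⟶ P' (n + 1))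
  (a : ∀ n, P n ⟶ P' n) (b : ∀ n, Q n ⟶ Q' n)
  (a' : ∀ n, P' n ⟶ P'' n) (b' : ∀ n, Q' n ⟶ Q'' n)

lemma eqToHom_family {P P' : ℤ → D} (a : ∀ n, P n ⟶ P' n) {m n : ℤ} (h : m = n) :
    a m = eqToHom (congrArg P h) ≫ a n ≫ eqToHom (congrArg P' h).symm := by
  subst h; simp

lemma interleaveD_even {i n : ℤ} (h : i = 2 * n) :
    interleaveD α β i = eqToHom (interleaveX_even P Q h) ≫ α n ≫
      eqToHom (interleaveX_odd P Q (by rw [h])).symm := by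
  have hi : Even i := ⟨n, by lia⟩
  have hn : i / 2 = n := by lia
  rw [interleaveD, dif_pos hi, eqToHom_family α hn]
  simp

lemma interleaveD_odd {i n : ℤ} (h : i = 2 * n + 1) :
    interleaveD α β i = eqToHom (interleaveX_odd P Q h) ≫ β n ≫
      eqToHom (interleaveX_even P Q (by lia)).symm := by
  have hi : ¬ Even i := by rw [h]; simp
  have hn : i / 2 = n := by lia
  rw [interleaveD, dif_neg hi, eqToHom_family (P' := fun n => P (n + 1)) β hn]
  simp

lemma interleaveMap_even {i n : ℤ} (h : i = 2 * n) :
    interleaveMap a b i = eqToHom (interleaveX_even P Q h) ≫ a n ≫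
      eqToHom (interleaveX_even P' Q' h).symm := by
  have hi : Even i := ⟨n, by lia⟩
  have hn : i / 2 = n := by lia
  rw [interleaveMap, dif_pos hi, eqToHom_family a hn]
  simp

lemma interleaveMap_odd {i n : ℤ} (h : i = 2 * n + 1) :
    interleaveMap a b i = eqToHom (interleaveX_odd P Q h) ≫ b n ≫
      eqToHom (interleaveX_odd P' Q' h).symm := by
  have hi : ¬ Even i := by rw [h]; simp
  have hn : i / 2 = n := by lia
  rw [interleaveMap, dif_neg hi, eqToHom_family b hn]
  simp

lemma even_or_odd' (i : ℤ) : (∃ n, i = 2 * n) ∨ ∃ n, i = 2 * n + 1 := by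
  rcases Int.even_or_odd i with ⟨k, hk⟩ | ⟨k, hk⟩
  · exact Or.inl ⟨k, by lia⟩
  · exact Or.inr ⟨k, hk⟩

lemma interleaveD_sq [HasZeroMorphisms D] (h₁ : ∀ n, α n ≫ β n = 0)
    (h₂ : ∀ n, β n ≫ α (n + 1) = 0) (i : ℤ) :
    interleaveD α β i ≫ interleaveD α β (i + 1) = 0 := by
  rcases even_or_odd' i with ⟨n, h⟩ | ⟨n, h⟩
  · rw [interleaveD_even α β h, interleaveD_odd α β (n := n) (by lia)]
    simp [reassoc_of% (h₁ n)]
  · rw [interleaveD_odd α β h, interleaveD_even α β (n := n + 1) (by lia)]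
    simp [reassoc_of% (h₂ n)]

lemma interleaveMap_comm (h₁ : ∀ n, α n ≫ b n = a n ≫ α' n)
    (h₂ : ∀ n, β n ≫ a (n + 1) = b n ≫ β' n) (i : ℤ) :
    interleaveMap a b i ≫ interleaveD α' β' i =
      interleaveD α β i ≫ interleaveMap a b (i + 1) := by
  rcases even_or_odd' i with ⟨n, h⟩ | ⟨n, h⟩
  · rw [interleaveD_even α β h, interleaveD_even α' β' h, interleaveMap_even a b h,
      interleaveMap_odd a b (n := n) (by lia)]
    simp [reassoc_of% (h₁ n)]
  · rw [interleaveD_odd α β h, interleaveD_odd α' β' h, interleaveMap_odd a b h,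
      interleaveMap_even a b (n := n + 1) (by lia)]
    simp [reassoc_of% (h₂ n)]

lemma interleaveMap_id (i : ℤ) :
    interleaveMap (fun n => 𝟙 (P n)) (fun n => 𝟙 (Q n)) i = 𝟙 _ := by
  unfold interleaveMap; split_ifs <;> simp

lemma interleaveMap_comp (i : ℤ) :
    interleaveMap (fun n => a n ≫ a' n) (fun n => b n ≫ b' n) i =
      interleaveMap a b i ≫ interleaveMap a' b' i := by
  unfold interleaveMap; split_ifs <;> simp

end

variable {C : Type u'} [Category.{v'} C] {S : C ⥤ C} (z : CentralElement S)
  [HasZeroMorphisms D] (P : ℤ → C ⥤ D) (κ : ∀ n, S ⋙ P n ≅ P (n + 1))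
  (hP : ∀ n M, (P n).map (z.η.app M) = 0)

/-- For functors `P n` that kill the central element and identifications `κ n : P n S ≅ P (n + 1)`,
the functor sending a factorization `(M, N, f, g)` to the complex
`⋯ ⟶ P n M --f--> P n N --g--> P n (S M) ≅ P (n + 1) M ⟶ ⋯` with `P 0 M` in degree zero. -/
def complexFunctor : Fact z ⥤ CochainComplex D ℤ where
  obj X := CochainComplex.of
    (interleaveX (fun n => (P n).obj X.M) (fun n => (P n).obj X.N))
    (interleaveD (fun n => (P n).map X.f) (fun n => (P n).map X.g ≫ (κ n).hom.app X.M))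
    (interleaveD_sq _ _
      (fun n => by rw [← Category.assoc, ← (P n).map_comp, X.f_g, hP, zero_comp])
      (fun n => by
        rw [Category.assoc, ← (κ n).hom.naturality X.f, Functor.comp_map, ← Category.assoc,
          ← (P n).map_comp, X.g_f, hP, zero_comp]))
  map {X Y} θ := CochainComplex.ofHom
    (interleaveMap (fun n => (P n).map θ.ψ) (fun n => (P n).map θ.φ))
    (fun i => by
      dsimp only
      rw [CochainComplex.of_d, CochainComplex.of_d]
      exact interleaveMap_comm _ _ _ _ _ _
        (fun n => by rw [← (P n).map_comp, θ.comm_f, (P n).map_comp])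
        (fun n => by
          rw [Category.assoc, ← (κ n).hom.naturality θ.ψ, Functor.comp_map, ← Category.assoc,
            ← (P n).map_comp, θ.comm_g, (P n).map_comp, Category.assoc]) i)
  map_id X := by
    ext i
    simp [interleaveMap_id]
  map_comp a b := by
    ext i
    simp [interleaveMap_comp]

end Interleave

/-! ### Twisted modules and reduction modulo a central element -/

section Modules

variable {B : Type u} [Ring B]

instance (w : Subring.center B) : (Ideal.span {(w : B)}).IsTwoSided where
  mul_mem_of_left b h := by
    obtain ⟨c, rfl⟩ := Ideal.mem_span_singleton'.1 h
    refine Ideal.mem_span_singleton'.2 ⟨c * b, ?_⟩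
    rw [mul_assoc, mul_assoc, Subring.mem_center_iff.1 w.2 b]

/-- The factor ring `A = B / (w)`. -/
abbrev RedRing (w : Subring.center B) : Type u := B ⧸ Ideal.span {(w : B)}

/-- The twisting functor `S_ν`: it sends `M` to the module `M` on which `b` acts as `ν b`, and is
the identity on maps. -/
noncomputable abbrev twist (ν : B ≃+* B) : ModuleCat.{v} B ⥤ ModuleCat.{v} B :=
  ModuleCat.restrictScalars (ν : B →+* B)

variable (w : Subring.center B) (ν : B ≃+* B)

lemma fix_smul (hν : ∀ b : B, ν (b * w) = b * w) {M : Type v}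
    [AddCommGroup M] [Module B M] (b : B) (m : M) :
    (w : B) • b • m = ν b • (w : B) • m := by
  have hw : ν (w : B) = w := by simpa using hν 1
  have h : (w : B) * b = ν b * w := by
    rw [← Subring.mem_center_iff.1 w.2 b, ← hν b, map_mul, hw]
  rw [smul_smul, smul_smul, h]

/-- The central element `η_w` of `(Mod B, S_ν)`, with coordinates `M ⟶ S_ν M`, `m ↦ w m`. -/
noncomputable def etaMod (hν : ∀ b : B, ν (b * w) = b * w) :
     CentralElement (twist.{v} ν) where
  η :=
    { app M := ModuleCat.ofHom (Y := (twist ν).obj M)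
        { toFun := fun m => ((w : B) • m : M)
          map_add' := fun m m' => smul_add (w : B) (m : M) m'
          map_smul' := fun b m => fix_smul w ν hν b (m : M) }
      naturality M N h := by
        ext m
        exact (h.hom.map_smul (w : B) m).symm }
  app_obj M := by
    ext m
    have hw : ν (w : B) = w := by simpa using hν 1
    have h : ν (w : B) • (show M from m) = (w : B) • (show M from m) := by rw [hw]
    exact h

/-- The submodule `w M = (w) M` of `M`. -/
abbrev wSub (M : Type v) [AddCommGroup M] [Module B M] : Submodule B M :=
  Ideal.span {(w : B)} • (⊤ : Submodule B M)

lemma mem_wSub {M : Type v} [AddCommGroup M] [Module B M] {x : M} :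
    x ∈ wSub w M ↔ ∃ m : M, x = (w : B) • m := by
  constructor
  · intro h
    induction h using Submodule.smul_induction_on' with
    | smul r hr m _ =>
      obtain ⟨c, rfl⟩ := Ideal.mem_span_singleton'.1 hr
      exact ⟨c • m, by rw [smul_smul, Subring.mem_center_iff.1 w.2 c]⟩
    | add x _ y _ hx hy =>
      obtain ⟨m, rfl⟩ := hx
      obtain ⟨m', rfl⟩ := hy
      exact ⟨m + m', by rw [smul_add]⟩
  · rintro ⟨m, rfl⟩
    exact Submodule.smul_mem_smul (Ideal.mem_span_singleton_self _) trivial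

lemma wSub_le_comap {M N : Type v} [AddCommGroup M] [Module B M] [AddCommGroup N] [Module B N]
    (h : M →ₗ[B] N) : wSub w M ≤ (wSub w N).comap h := by
  intro x hx
  obtain ⟨m, rfl⟩ := (mem_wSub w).1 hx
  exact (mem_wSub w).2 ⟨h m, by simp⟩

/-- The `A`-linear map `M / w M ⟶ N / w N` induced by a `B`-linear map. -/
def redMap {M N : Type v} [AddCommGroup M] [Module B M] [AddCommGroup N] [Module B N]
    (h : M →ₗ[B] N) : (M ⧸ wSub w M) →ₗ[RedRing w] (N ⧸ wSub w N) where
  toFun := Submodule.mapQ (wSub w M) (wSub w N) h (wSub_le_comap w h)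
  map_add' := map_add _
  map_smul' a x := by
    obtain ⟨b, rfl⟩ := Ideal.Quotient.mk_surjective a
    exact (Submodule.mapQ (wSub w M) (wSub w N) h (wSub_le_comap w h)).map_smul b x

lemma redMap_mk {M N : Type v} [AddCommGroup M] [Module B M] [AddCommGroup N] [Module B N]
    (h : M →ₗ[B] N) (m : M) :
    redMap w h (Submodule.Quotient.mk m) = Submodule.Quotient.mk (h m) := rfl

lemma redMap_id (M : Type v) [AddCommGroup M] [Module B M] :
    redMap w (LinearMap.id : M →ₗ[B] M) = LinearMap.id := by
  refine LinearMap.ext fun x => ?_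
  obtain ⟨m, rfl⟩ := Submodule.Quotient.mk_surjective _ x
  rfl

lemma redMap_comp {M N L : Type v} [AddCommGroup M] [Module B M] [AddCommGroup N] [Module B N]
    [AddCommGroup L] [Module B L] (h : M →ₗ[B] N) (k : N →ₗ[B] L) :
    redMap w (k.comp h) = (redMap w k).comp (redMap w h) := by
  refine LinearMap.ext fun x => ?_
  obtain ⟨m, rfl⟩ := Submodule.Quotient.mk_surjective _ x
  rfl

/-- Reduction modulo `w`, the functor `M ↦ M / w M` from `B`-modules to `A`-modules. -/
def reduction : ModuleCat.{v} B ⥤ ModuleCat.{v} (RedRing w) where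
  obj M := ModuleCat.of (RedRing w) (M ⧸ wSub w M)
  map h := ModuleCat.ofHom (redMap w h.hom)
  map_id M := ModuleCat.hom_ext (redMap_id w M)
  map_comp h k := ModuleCat.hom_ext (redMap_comp w h.hom k.hom)

lemma span_eq_map (hν : ∀ b : B, ν (b * w) = b * w) :
    Ideal.span {(w : B)} = (Ideal.span {(w : B)}).map (ν : B →+* B) := by
  have hw : ν (w : B) = w := by simpa using hν 1
  rw [Ideal.map_span, Set.image_singleton]
  simp [hw]

/-- The automorphism of `A` induced by `ν`. -/
def redAut (hν : ∀ b : B, ν (b * w) = b * w) : RedRing w ≃+* RedRing w :=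
  Ideal.quotientEquiv _ _ ν (span_eq_map w ν hν)

/-- A `ν`-semilinear bijection `T ≃ M` induces a bijection `T / w T ≃ M / w M`. -/
def redCongr (hν : ∀ b : B, ν (b * w) = b * w) {T M : Type v} [AddCommGroup T] [Module B T]
    [AddCommGroup M] [Module B M] (e : T ≃+ M) (he : ∀ (b : B) (t : T), e (b • t) = ν b • e t) :
    (T ⧸ wSub w T) ≃+ (M ⧸ wSub w M) :=
  QuotientAddGroup.congr (wSub w T).toAddSubgroup (wSub w M).toAddSubgroup e (by
    have hw : ν (w : B) = w := by simpa using hν 1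
    ext x
    constructor
    · rintro ⟨y, hy, rfl⟩
      obtain ⟨t, rfl⟩ := (mem_wSub w).1 hy
      refine (mem_wSub w).2 ⟨e t, ?_⟩
      have := he w t
      rw [hw] at this
      exact this
    · intro hx
      obtain ⟨m, rfl⟩ := (mem_wSub w).1 hx
      refine ⟨(w : B) • e.symm m, (mem_wSub w).2 ⟨_, rfl⟩, ?_⟩
      have := he w (e.symm m)
      rw [hw, e.apply_symm_apply] at this
      exact this)

lemma redCongr_smul (hν : ∀ b : B, ν (b * w) = b * w) {T M : Type v} [AddCommGroup T]
    [Module B T] [AddCommGroup M] [Module B M] (e : T ≃+ M)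
    (he : ∀ (b : B) (t : T), e (b • t) = ν b • e t) (a : RedRing w) (x : T ⧸ wSub w T) :
    redCongr w ν hν e he (a • x) = redAut w ν hν a • redCongr w ν hν e he x := by
  obtain ⟨b, rfl⟩ := Ideal.Quotient.mk_surjective a
  obtain ⟨t, rfl⟩ := Submodule.Quotient.mk_surjective _ x
  exact congrArg (Submodule.Quotient.mk (p := wSub w M)) (he b t)

/-- The identification `S_ν M / w S_ν M = _ν(M / w M)` for a single module. -/
noncomputable def redTwistEquiv (hν : ∀ b : B, ν (b * w) = b * w) (M : ModuleCat.{v} B) :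
    (reduction w).obj ((twist ν).obj M) ≃ₗ[RedRing w]
      (twist (redAut w ν hν)).obj ((reduction w).obj M) :=
  { redCongr w ν hν (T := (twist ν).obj M) (M := M) (AddEquiv.refl M) (fun _ _ => rfl) with
    map_smul' := redCongr_smul w ν hν (T := (twist ν).obj M) (M := M) (AddEquiv.refl M)
      (fun _ _ => rfl) }

/-- The identification `S_ν M / w S_ν M = _ν(M / w M)`, the identity on representatives. -/
noncomputable def reductionTwistIso (hν : ∀ b : B, ν (b * w) = b * w) :
    twist.{v} ν ⋙ reduction w ≅ reduction w ⋙ twist (redAut w ν hν) :=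
  NatIso.ofComponents (fun M => LinearEquiv.toModuleIso (redTwistEquiv w ν hν M)) (by
    intro M N h
    refine ModuleCat.hom_ext (LinearMap.ext fun x => ?_)
    obtain ⟨m, rfl⟩ := Submodule.Quotient.mk_surjective _ x
    rfl)

/-- The functor `M ↦ _{ν^n}(M / w M)` from `B`-modules to `A`-modules. -/
noncomputable def twistedReduction (hν : ∀ b : B, ν (b * w) = b * w) (n : ℤ) :
    ModuleCat.{v} B ⥤ ModuleCat.{v} (RedRing w) :=
  reduction w ⋙ twist (redAut w ν hν ^ n)

/-- The identification `_{ν^n}(S_ν M / w S_ν M) = _{ν^{n+1}}(M / w M)`, the identity on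
representatives. -/
noncomputable def twistedReductionIso (hν : ∀ b : B, ν (b * w) = b * w) (n : ℤ) :
    twist.{v} ν ⋙ twistedReduction w ν hν n ≅ twistedReduction w ν hν (n + 1) :=
  Functor.isoWhiskerRight (reductionTwistIso w ν hν) (twist (redAut w ν hν ^ n)) ≪≫
    Functor.isoWhiskerLeft (reduction w)
      (ModuleCat.restrictScalarsComp' (redAut w ν hν ^ n : RedRing w ≃+* RedRing w).toRingHom
        (redAut w ν hν).toRingHom (redAut w ν hν ^ (n + 1) : RedRing w ≃+* RedRing w).toRingHom
        (by rw [add_comm, zpow_one_add]; rfl)).symm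

lemma twistedReduction_eta (hν : ∀ b : B, ν (b * w) = b * w) (n : ℤ) (M : ModuleCat.{v} B) :
    (twistedReduction w ν hν n).map ((etaMod w ν hν).η.app M) = 0 := by
  refine ModuleCat.hom_ext (LinearMap.ext fun x => ?_)
  obtain ⟨m, rfl⟩ := Submodule.Quotient.mk_surjective _ x
  refine (Submodule.Quotient.mk_eq_zero _).2 ?_
  exact (mem_wSub w (M := (twist ν).obj M)).2 (by
    have hw : ν (w : B) = w := by simpa using hν 1
    refine ⟨m, ?_⟩
    have h : (w : B) • (show M from m) = ν (w : B) • (show M from m) := by rw [hw]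
    exact h)

/-- The functor sending a factorization `(M, N, f, g)` of `η_w` to the complex of `A`-modules
`⋯ ⟶ _{ν^n}(M / w M) --f--> _{ν^n}(N / w N) --g--> _{ν^{n+1}}(M / w M) ⟶ ⋯`
with `M / w M` in degree zero. -/
noncomputable def reductionComplex (hν : ∀ b : B, ν (b * w) = b * w) :
    Fact (etaMod.{v} w ν hν) ⥤ CochainComplex (ModuleCat.{v} (RedRing w)) ℤ :=
  complexFunctor (etaMod w ν hν) (twistedReduction w ν hν) (twistedReductionIso w ν hν)
    (twistedReduction_eta w ν hν)

end Modules

/-! ### Finitely generated free modules -/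

section Free

/-- Finitely generated free modules. -/
def isFGFree (R : Type u) [Ring R] : ObjectProperty (ModuleCat.{v} R) :=
  fun M => Module.Free R M ∧ Module.Finite R M

/-- The category `F(R)` of finitely generated free `R`-modules. -/
abbrev FreeCat (R : Type u) [Ring R] := (isFGFree.{v} R).FullSubcategory

instance (R : Type u) [Ring R] : (isFGFree.{v} R).IsClosedUnderIsomorphisms where
  of_iso e h := by
    obtain ⟨h₁, h₂⟩ := h
    exact ⟨Module.Free.of_equiv e.toLinearEquiv, Module.Finite.equiv e.toLinearEquiv⟩

instance (R : Type u) [Ring R] : (isFGFree.{v} R).ContainsZero where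
  exists_zero := ⟨ModuleCat.of R PUnit, ModuleCat.isZero_of_subsingleton _,
    ⟨inferInstanceAs (Module.Free R PUnit.{v + 1}), inferInstanceAs (Module.Finite R PUnit.{v + 1})⟩⟩

instance (R : Type u) [Ring R] : HasBinaryBiproducts (FreeCat.{v} R) where
  has_binary_biproduct X Y := by
    have hX : Module.Free R X.obj ∧ Module.Finite R X.obj := X.property
    have hY : Module.Free R Y.obj ∧ Module.Finite R Y.obj := Y.property
    have := hX.1
    have := hX.2
    have := hY.1
    have := hY.2
    let P : FreeCat.{v} R := ⟨ModuleCat.of R (X.obj × Y.obj),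
      inferInstanceAs (Module.Free R (X.obj × Y.obj)),
      inferInstanceAs (Module.Finite R (X.obj × Y.obj))⟩
    let b : BinaryBicone X Y :=
      { pt := P
        fst := ObjectProperty.homMk (ModuleCat.ofHom (LinearMap.fst R X.obj Y.obj))
        snd := ObjectProperty.homMk (ModuleCat.ofHom (LinearMap.snd R X.obj Y.obj))
        inl := ObjectProperty.homMk (ModuleCat.ofHom (LinearMap.inl R X.obj Y.obj))
        inr := ObjectProperty.homMk (ModuleCat.ofHom (LinearMap.inr R X.obj Y.obj))
        inl_fst := rfl
        inl_snd := rfl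
        inr_fst := rfl
        inr_snd := rfl }
    refine hasBinaryBiproduct_of_total b (ObjectProperty.hom_ext _ (ModuleCat.hom_ext ?_))
    exact LinearMap.coprod_inl_inr

variable {B : Type u} [Ring B]

lemma isFGFree_twist (ν : B ≃+* B) (M : ModuleCat.{v} B) (h : isFGFree B M) :
    isFGFree B ((twist ν).obj M) := by
  obtain ⟨h₁, h₂⟩ := h
  let _ : RingHomInvPair (ν.symm : B →+* B) (ν : B →+* B) := RingHomInvPair.of_ringEquiv ν.symm
  let _ : RingHomInvPair (ν : B →+* B) (ν.symm : B →+* B) := RingHomInvPair.of_ringEquiv ν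
  let e : M ≃ₛₗ[(ν.symm : B →+* B)] (twist ν).obj M :=
    { AddEquiv.refl M with
      map_smul' := fun b m => by
        have h : b • (m : M) = ν (ν.symm b) • (m : M) := by rw [ν.apply_symm_apply]
        exact h }
  exact ⟨Module.Free.of_equiv e, Module.Finite.of_surjective e.toLinearMap e.surjective⟩

variable (w : Subring.center B) (ν : B ≃+* B)

lemma linearCombination_red {M : Type v} [AddCommGroup M] [Module B M] {ι : Type v} (b : ι → M)
    (l : ι →₀ B) :
    Finsupp.linearCombination (RedRing w) (fun i => (Submodule.Quotient.mk (b i) : M ⧸ wSub w M))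
      (l.mapRange (Ideal.Quotient.mk (Ideal.span {(w : B)})) (map_zero _)) =
    Submodule.Quotient.mk (Finsupp.linearCombination B b l) := by
  induction l using Finsupp.induction_linear with
  | zero => simp
  | add l l' h h' =>
    rw [Finsupp.mapRange_add (map_add _), map_add, map_add, h, h', Submodule.Quotient.mk_add]
  | single i c =>
    rw [Finsupp.mapRange_single, Finsupp.linearCombination_single,
      Finsupp.linearCombination_single]
    rfl

lemma isFGFree_reduction (M : ModuleCat.{v} B) (h : isFGFree B M) :
    isFGFree (RedRing w) ((reduction w).obj M) := by
  obtain ⟨h₁, h₂⟩ := h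
  constructor
  · let b := Module.Free.chooseBasis B M
    refine Module.Free.of_basis (Module.Basis.mk (R := RedRing w) (M := M ⧸ wSub w M)
      (v := fun i => Submodule.Quotient.mk (b i)) ?_ ?_)
    · rw [linearIndependent_iff]
      intro l hl
      obtain ⟨l, rfl⟩ := Finsupp.mapRange_surjective _ (map_zero _)
        (Ideal.Quotient.mk_surjective (I := Ideal.span {(w : B)})) l
      rw [linearCombination_red, Submodule.Quotient.mk_eq_zero, mem_wSub] at hl
      obtain ⟨m, hm⟩ := hl
      have hl' : l = (w : B) • b.repr m := by
        rw [← map_smul, ← hm, b.repr_linearCombination]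
      ext i
      rw [Finsupp.mapRange_apply, hl', Finsupp.smul_apply, smul_eq_mul, Finsupp.zero_apply,
        Ideal.Quotient.eq_zero_iff_mem]
      exact Ideal.mul_mem_right _ _ (Ideal.mem_span_singleton_self _)
    · intro x _
      obtain ⟨m, rfl⟩ := Submodule.Quotient.mk_surjective _ x
      rw [← b.linearCombination_repr m, ← linearCombination_red]
      exact (Finsupp.mem_span_range_iff_exists_finsupp).2 ⟨_, rfl⟩
  · let σ : B →+* RedRing w := Ideal.Quotient.mk _
    let f : M →ₛₗ[σ] (M ⧸ wSub w M) :=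
      { toFun := Submodule.Quotient.mk
        map_add' := fun _ _ => rfl
        map_smul' := fun _ _ => rfl }
    have : RingHomSurjective σ := ⟨Ideal.Quotient.mk_surjective⟩
    exact Module.Finite.of_surjective f (Submodule.Quotient.mk_surjective _)

/-- The twisting functor on finitely generated free modules. -/
noncomputable abbrev twistFree : FreeCat.{v} B ⥤ FreeCat.{v} B :=
  (isFGFree B).lift ((isFGFree B).ι ⋙ twist ν) (fun F => isFGFree_twist ν F.obj F.property)

instance : (twistFree.{v} ν).Additive where
  map_add := rfl

/-- The central element `η_w` of `(F(B), S_ν)`, the restriction of the one on all modules. -/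
noncomputable def etaFree (hν : ∀ b : B, ν (b * w) = b * w) : CentralElement (twistFree.{v} ν) where
  η :=
    { app F := ObjectProperty.homMk ((etaMod w ν hν).η.app F.obj)
      naturality _ _ h := ObjectProperty.hom_ext _ ((etaMod w ν hν).η.naturality h.hom) }
  app_obj F := ObjectProperty.hom_ext _ ((etaMod w ν hν).app_obj F.obj)

/-- The restriction of `M ↦ _{ν^n}(M / w M)` to finitely generated free modules. -/
noncomputable def twistedReductionFree (hν : ∀ b : B, ν (b * w) = b * w) (n : ℤ) :
    FreeCat.{v} B ⥤ FreeCat.{v} (RedRing w) :=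
  (isFGFree (RedRing w)).lift ((isFGFree B).ι ⋙ twistedReduction w ν hν n)
    (fun F => isFGFree_twist _ _ (isFGFree_reduction w F.obj F.property))

/-- The restriction of the identification `_{ν^n}(S_ν M / w S_ν M) = _{ν^{n+1}}(M / w M)`. -/
noncomputable def twistedReductionFreeIso (hν : ∀ b : B, ν (b * w) = b * w) (n : ℤ) :
    twistFree.{v} ν ⋙ twistedReductionFree w ν hν n ≅ twistedReductionFree w ν hν (n + 1) :=
  NatIso.ofComponents
    (fun F => ObjectProperty.isoMk _ ((twistedReductionIso w ν hν n).app F.obj))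
    (fun h => ObjectProperty.hom_ext _ ((twistedReductionIso w ν hν n).hom.naturality h.hom))

/-- The functor sending a factorization `(M, N, f, g)` of `η_w` by finitely generated free modules
to the complex of finitely generated free `A`-modules
`⋯ ⟶ _{ν^n}(M / w M) --f--> _{ν^n}(N / w N) --g--> _{ν^{n+1}}(M / w M) ⟶ ⋯`
with `M / w M` in degree zero. -/
noncomputable def reductionComplexFree (hν : ∀ b : B, ν (b * w) = b * w) :
    Fact (etaFree.{v} w ν hν) ⥤ CochainComplex (FreeCat.{v} (RedRing w)) ℤ :=
  complexFunctor (etaFree w ν hν) (twistedReductionFree w ν hν) (twistedReductionFreeIso w ν hν)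
    (fun n F => ObjectProperty.hom_ext _ (twistedReduction_eta w ν hν n F.obj))

end Free

end TwFact

/-! Both statements are instances of one statement about additive functors `P n : C ⥤ D` that kill
`η` and are linked by natural isomorphisms `κ n` identifying `P n` after `S` with `P (n + 1)`. For
modules, `P n` is `M ↦ _{ν^n}(M / w M)`. Two consecutive maps of a factorization compose to `η`, so
after applying `P n` they compose to zero, and the `κ n` join the pieces into a complex.

Each structure on factorizations becomes the corresponding structure on complexes. In a homotopy
`(s, t)`, `s` supplies the maps from odd to even degree and `t`, preceded by the inverse of `κ n`,
those from even to odd degree (`complexFunctor_homotopic`). The suspension negates both maps, just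
as the shift negates the differential, so the two complexes differ only by `κ n` in odd degrees
(`complexSuspensionIso`). The matrices of the cone of a factorization are those of the mapping cone
of complexes, and an additive `P n` preserves the biproducts (`coneComparison`). The last two
comparisons are isomorphisms of complexes, before passing to homotopy.

One sign remains. In the standard triangles of `K(D)` the third morphism is minus the projection,
while for factorizations it is the projection itself (`coneComparison_π`). The negative of a natural
isomorphism is again one, so the sign is put into the isomorphism between the suspensions
(`hComplexSuspensionIso`). Every distinguished triangle then goes to one isomorphic to a standard
triangle. -/

namespace TwFact

/-- A family indexed by `ℤ` is given by its members of even and of odd index. -/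
def parityRec {F : ℤ → Sort*} (a : ∀ i n, i = 2 * n → F i) (b : ∀ i n, i = 2 * n + 1 → F i)
    (i : ℤ) : F i :=
  if h : Even i then a i (i / 2) (eq_two_mul_of_even h)
  else b i (i / 2) (eq_two_mul_add_one_of_not_even h)

/-- Because `a` takes `n` together with a proof of `i = 2 * n`, the value can be read off for any
`n` presenting `i`, with no transport along `i / 2 = n`. -/
lemma parityRec_even {F : ℤ → Sort*} (a : ∀ i n, i = 2 * n → F i)
    (b : ∀ i n, i = 2 * n + 1 → F i) {i n : ℤ} (h : i = 2 * n) :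
    parityRec a b i = a i n h := by
  have hi : Even i := ⟨n, by lia⟩
  obtain rfl : i / 2 = n := by lia
  rw [parityRec, dif_pos hi]

lemma parityRec_odd {F : ℤ → Sort*} (a : ∀ i n, i = 2 * n → F i)
    (b : ∀ i n, i = 2 * n + 1 → F i) {i n : ℤ} (h : i = 2 * n + 1) :
    parityRec a b i = b i n h := by
  have hi : ¬ Even i := by rw [h]; simp
  obtain rfl : i / 2 = n := by lia
  rw [parityRec, dif_neg hi]

/-! ### Terms, differentials and shift of the complex of a factorization -/

section ComplexFunctor

variable {D : Type u} [Category.{v} D] {C : Type u'} [Category.{v'} C] {S : C ⥤ C}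
  {z : CentralElement S}

/-- Naturality of `κ n` with the composite functor unfolded, so that it can be used for rewriting.
It moves a map from `P n` after `S` to `P (n + 1)`. -/
lemma twist_hom_naturality {P : ℤ → C ⥤ D} (κ : ∀ n, S ⋙ P n ≅ P (n + 1)) (n : ℤ) {M N : C} (h : M ⟶ N) :
    (P n).map (S.map h) ≫ (κ n).hom.app N = (κ n).hom.app M ≫ (P (n + 1)).map h :=
  (κ n).hom.naturality h

section

variable [HasZeroMorphisms D] {P : ℤ → C ⥤ D} {κ : ∀ n, S ⋙ P n ≅ P (n + 1)}
  {hP : ∀ n M, (P n).map (z.η.app M) = 0}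

/-- The term of even degree `2 n` of the complex of a factorization. -/
def evenIso (X : Fact z) (i n : ℤ) (h : i = 2 * n) :
    ((complexFunctor z P κ hP).obj X).X i ≅ (P n).obj X.M :=
  eqToIso (interleaveX_even (fun n => (P n).obj X.M) (fun n => (P n).obj X.N) h)

/-- The term of odd degree `2 n + 1` of the complex of a factorization. -/
def oddIso (X : Fact z) (i n : ℤ) (h : i = 2 * n + 1) :
    ((complexFunctor z P κ hP).obj X).X i ≅ (P n).obj X.N :=
  eqToIso (interleaveX_odd (fun n => (P n).obj X.M) (fun n => (P n).obj X.N) h)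

/-- Source and target degrees are separate variables tied to `n` by equations, so the formula
applies to `i - 1`, `i` and `i + 1` alike. -/
lemma complexFunctor_d_even (X : Fact z) (i j n : ℤ) (hi : i = 2 * n) (hj : j = 2 * n + 1) :
    ((complexFunctor z P κ hP).obj X).d i j =
      (evenIso X i n hi).hom ≫ (P n).map X.f ≫ (oddIso X j n hj).inv := by
  obtain rfl : j = i + 1 := by lia
  exact (CochainComplex.of_d _ _ _).trans (interleaveD_even _ _ hi)

lemma complexFunctor_d_odd (X : Fact z) (i j n : ℤ) (hi : i = 2 * n + 1)
    (hj : j = 2 * (n + 1)) :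
    ((complexFunctor z P κ hP).obj X).d i j =
      (oddIso X i n hi).hom ≫ (P n).map X.g ≫ (κ n).hom.app X.M ≫
        (evenIso X j (n + 1) hj).inv := by
  obtain rfl : j = i + 1 := by lia
  exact (CochainComplex.of_d _ _ _).trans ((interleaveD_odd _ _ hi).trans (by
    simp only [Category.assoc]
    rfl))

lemma complexFunctor_map_even {X Y : Fact z} (θ : X ⟶ Y) (i n : ℤ) (hi : i = 2 * n) :
    ((complexFunctor z P κ hP).map θ).f i =
      (evenIso X i n hi).hom ≫ (P n).map θ.ψ ≫ (evenIso Y i n hi).inv :=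
  interleaveMap_even (fun n => (P n).map θ.ψ) (fun n => (P n).map θ.φ) hi

lemma complexFunctor_map_odd {X Y : Fact z} (θ : X ⟶ Y) (i n : ℤ) (hi : i = 2 * n + 1) :
    ((complexFunctor z P κ hP).map θ).f i =
      (oddIso X i n hi).hom ≫ (P n).map θ.φ ≫ (oddIso Y i n hi).inv :=
  interleaveMap_odd (fun n => (P n).map θ.ψ) (fun n => (P n).map θ.φ) hi

end

variable [Preadditive D] {P : ℤ → C ⥤ D} {κ : ∀ n, S ⋙ P n ≅ P (n + 1)}
  {hP : ∀ n M, (P n).map (z.η.app M) = 0}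

/-- The term of even degree of the shift of the complex of a factorization. -/
def shiftEvenIso (X : Fact z) (i n : ℤ) (h : i = 2 * n) :
    (((complexFunctor z P κ hP).obj X)⟦(1 : ℤ)⟧).X i ≅ (P n).obj X.N :=
  oddIso (κ := κ) (hP := hP) X (i + 1) n (by rw [h])

/-- The term of odd degree of the shift of the complex of a factorization. -/
def shiftOddIso (X : Fact z) (i n : ℤ) (h : i = 2 * n + 1) :
    (((complexFunctor z P κ hP).obj X)⟦(1 : ℤ)⟧).X i ≅ (P (n + 1)).obj X.M :=
  evenIso (κ := κ) (hP := hP) X (i + 1) (n + 1) (by lia)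

/-- The shift by one multiplies the differential by `-1`. The sign is placed on the image of `g`,
where the suspension of factorizations has it too. -/
lemma shift_d_even (X : Fact z) (i j n : ℤ) (hi : i = 2 * n) (hj : j = 2 * n + 1) :
    (((complexFunctor z P κ hP).obj X)⟦(1 : ℤ)⟧).d i j =
      (shiftEvenIso X i n hi).hom ≫ (-(P n).map X.g) ≫ (κ n).hom.app X.M ≫
        (shiftOddIso X j n hj).inv := by
  rw [CochainComplex.shiftFunctor_obj_d',
    complexFunctor_d_odd X (i + 1) (j + 1) n (by lia) (by lia), Int.negOnePow_one,
    Units.neg_smul, one_smul, Preadditive.neg_comp, Preadditive.comp_neg]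
  rfl

lemma shift_d_odd (X : Fact z) (i j n : ℤ) (hi : i = 2 * n + 1) (hj : j = 2 * (n + 1)) :
    (((complexFunctor z P κ hP).obj X)⟦(1 : ℤ)⟧).d i j =
      (shiftOddIso X i n hi).hom ≫ (-(P (n + 1)).map X.f) ≫ (shiftEvenIso X j (n + 1) hj).inv := by
  rw [CochainComplex.shiftFunctor_obj_d',
    complexFunctor_d_even X (i + 1) (j + 1) (n + 1) (by lia) (by lia), Int.negOnePow_one,
    Units.neg_smul, one_smul, Preadditive.neg_comp, Preadditive.comp_neg]
  rfl

lemma shift_map_even {X Y : Fact z} (θ : X ⟶ Y) (i n : ℤ) (hi : i = 2 * n) :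
    (((complexFunctor z P κ hP).map θ)⟦(1 : ℤ)⟧').f i =
      (shiftEvenIso X i n hi).hom ≫ (P n).map θ.φ ≫ (shiftEvenIso Y i n hi).inv :=
  complexFunctor_map_odd θ (i + 1) n (by rw [hi])

lemma shift_map_odd {X Y : Fact z} (θ : X ⟶ Y) (i n : ℤ) (hi : i = 2 * n + 1) :
    (((complexFunctor z P κ hP).map θ)⟦(1 : ℤ)⟧').f i =
      (shiftOddIso X i n hi).hom ≫ (P (n + 1)).map θ.ψ ≫ (shiftOddIso Y i n hi).inv :=
  complexFunctor_map_even θ (i + 1) (n + 1) (by lia)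

variable [Preadditive C] [S.Additive]

/-- The term of even degree of the complex of a suspension. -/
def suspensionEvenIso (X : Fact z) (i n : ℤ) (h : i = 2 * n) :
    ((complexFunctor z P κ hP).obj ((Fact.suspension z).obj X)).X i ≅ (P n).obj X.N :=
  evenIso ((Fact.suspension z).obj X) i n h

/-- The term of odd degree of the complex of a suspension. -/
def suspensionOddIso (X : Fact z) (i n : ℤ) (h : i = 2 * n + 1) :
    ((complexFunctor z P κ hP).obj ((Fact.suspension z).obj X)).X i ≅ (P n).obj (S.obj X.M) :=
  oddIso ((Fact.suspension z).obj X) i n h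

lemma suspension_map_even {X Y : Fact z} (θ : X ⟶ Y) (i n : ℤ) (hi : i = 2 * n) :
    ((complexFunctor z P κ hP).map ((Fact.suspension z).map θ)).f i =
      (suspensionEvenIso X i n hi).hom ≫ (P n).map θ.φ ≫ (suspensionEvenIso Y i n hi).inv :=
  complexFunctor_map_even _ i n hi

lemma suspension_map_odd {X Y : Fact z} (θ : X ⟶ Y) (i n : ℤ) (hi : i = 2 * n + 1) :
    ((complexFunctor z P κ hP).map ((Fact.suspension z).map θ)).f i =
      (suspensionOddIso X i n hi).hom ≫ (P n).map (S.map θ.ψ) ≫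
        (suspensionOddIso Y i n hi).inv :=
  complexFunctor_map_odd _ i n hi

/-- The components of the isomorphism between the complex of a suspension and the shift. -/
def complexSuspensionXIso (X : Fact z) (i : ℤ) :
    ((complexFunctor z P κ hP).obj ((Fact.suspension z).obj X)).X i ≅
      (((complexFunctor z P κ hP).obj X)⟦(1 : ℤ)⟧).X i :=
  parityRec (F := fun i => ((complexFunctor z P κ hP).obj ((Fact.suspension z).obj X)).X i ≅
      (((complexFunctor z P κ hP).obj X)⟦(1 : ℤ)⟧).X i)
    (fun i n h => suspensionEvenIso X i n h ≪≫ (shiftEvenIso X i n h).symm)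
    (fun i n h => suspensionOddIso X i n h ≪≫ (κ n).app X.M ≪≫ (shiftOddIso X i n h).symm) i

lemma complexSuspensionXIso_even (X : Fact z) (i n : ℤ) (h : i = 2 * n) :
    complexSuspensionXIso (P := P) (κ := κ) (hP := hP) X i =
      suspensionEvenIso X i n h ≪≫ (shiftEvenIso X i n h).symm :=
  parityRec_even _ _ h

lemma complexSuspensionXIso_odd (X : Fact z) (i n : ℤ) (h : i = 2 * n + 1) :
    complexSuspensionXIso (P := P) (κ := κ) (hP := hP) X i =
      suspensionOddIso X i n h ≪≫ (κ n).app X.M ≪≫ (shiftOddIso X i n h).symm :=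
  parityRec_odd _ _ h

/-! ### Additivity, homotopy invariance and compatibility with the suspension -/

variable [∀ n, (P n).Additive]

instance : (complexFunctor z P κ hP).Additive where
  map_add {X Y a b} := by
    ext i
    rw [HomologicalComplex.add_f_apply]
    rcases even_or_odd' i with ⟨n, h⟩ | ⟨n, h⟩
    · simp [complexFunctor_map_even _ i n h]
    · simp [complexFunctor_map_odd _ i n h]

/-- Homotopic morphisms of factorizations have homotopic images. -/
lemma complexFunctor_homotopic {X Y : Fact z} (θ θ' : X ⟶ Y) (h : Fact.Homotopic z θ θ') :
    (HomotopyCategory.quotient D (ComplexShape.up ℤ)).map ((complexFunctor z P κ hP).map θ) =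
      (HomotopyCategory.quotient D (ComplexShape.up ℤ)).map
        ((complexFunctor z P κ hP).map θ') := by
  obtain ⟨s, t, h₁, h₂⟩ := h
  refine HomotopyCategory.eq_of_homotopy _ _ (Homotopy.equivSubZero.symm ?_)
  -- Here `i = j + 1`. For even `j` the map comes from `s`; for odd `j` it comes from `t`, whose
  -- source `P n (S M)` is reached from `P (n + 1) M` by the inverse of `κ n`. No signs are needed.
  let H : ∀ j i : ℤ, (ComplexShape.up ℤ).Rel j i →
      (((complexFunctor z P κ hP).obj X).X i ⟶ ((complexFunctor z P κ hP).obj Y).X j) :=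
    parityRec
      (fun j n hj i hi => (oddIso X i n (by rw [← hj]; exact hi.symm)).hom ≫ (P n).map s ≫
        (evenIso Y j n hj).inv)
      (fun j n hj i hi =>
        (evenIso X i (n + 1) (by have : j + 1 = i := hi; lia)).hom ≫ (κ n).inv.app X.M ≫
          (P n).map t ≫ (oddIso Y j n hj).inv)
  refine (Homotopy.ofEq ?_).trans (Homotopy.nullHomotopy' fun i j hij => H j i hij)
  ext i
  rw [HomologicalComplex.sub_f_apply,
    Homotopy.nullHomotopicMap'_f (k₂ := i - 1) (k₀ := i + 1) (sub_add_cancel i 1) rfl]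
  rcases even_or_odd' i with ⟨n, hi⟩ | ⟨n, hi⟩
  -- The differential of `Y` into degree `2 * n` uses `κ` at `n - 1`; with `n = m + 1` its target is
  -- literally `P (m + 1)`.
  · obtain ⟨m, rfl⟩ : ∃ m, n = m + 1 := ⟨n - 1, by lia⟩
    -- The first homotopy equation is solved for `t ≫ Y.g`. This exhibits it as the image under `S`
    -- of a map, which naturality of `κ m` carries to `P (m + 1)`; no inverse of `S` is required.
    have e : t ≫ Y.g = S.map (θ.ψ - θ'.ψ - X.f ≫ s) := by rw [S.map_sub, h₁]; abel
    have e' : (P m).map t ≫ (P m).map Y.g ≫ (κ m).hom.app Y.M =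
        (κ m).hom.app X.M ≫ (P (m + 1)).map (θ.ψ - θ'.ψ - X.f ≫ s) := by
      rw [← twist_hom_naturality, ← e, Functor.map_comp, Category.assoc]
    simp only [H]
    rw [parityRec_even _ _ hi, parityRec_odd _ _ (i := i - 1) (n := m) (by lia),
      complexFunctor_map_even _ i _ hi, complexFunctor_map_even _ i _ hi,
      complexFunctor_d_even X i _ _ hi (by lia), complexFunctor_d_odd Y (i - 1) i m (by lia) hi]
    simp only [Category.assoc, Iso.inv_hom_id_assoc, reassoc_of% e', Iso.inv_hom_id_app_assoc,
      Functor.map_sub, Functor.map_comp, Preadditive.comp_sub, Preadditive.sub_comp]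
    abel
  · have e : (P n).map θ.φ = (P n).map θ'.φ + (P n).map X.g ≫ (P n).map t +
        (P n).map s ≫ (P n).map Y.f := by
      rw [← sub_add_cancel θ.φ θ'.φ, h₂]
      simp only [Functor.map_add, Functor.map_comp]
      abel
    simp only [H]
    rw [parityRec_odd _ _ hi, parityRec_even _ _ (i := i - 1) (n := n) (by lia),
      complexFunctor_map_odd _ i _ hi, complexFunctor_map_odd _ i _ hi,
      complexFunctor_d_odd X i _ n hi (by lia),
      complexFunctor_d_even Y (i - 1) i n (by lia) hi, e]
    simp only [Category.assoc, Iso.inv_hom_id_assoc, Iso.hom_inv_id_app_assoc,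
      Preadditive.comp_add, Preadditive.add_comp]
    abel

lemma suspension_d_even (X : Fact z) (i j n : ℤ) (hi : i = 2 * n) (hj : j = 2 * n + 1) :
    ((complexFunctor z P κ hP).obj ((Fact.suspension z).obj X)).d i j =
      (suspensionEvenIso X i n hi).hom ≫ (-(P n).map X.g) ≫ (suspensionOddIso X j n hj).inv :=
  (complexFunctor_d_even _ i j n hi hj).trans (by
    rw [← Functor.map_neg]; rfl)

lemma suspension_d_odd (X : Fact z) (i j n : ℤ) (hi : i = 2 * n + 1) (hj : j = 2 * (n + 1)) :
    ((complexFunctor z P κ hP).obj ((Fact.suspension z).obj X)).d i j =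
      (suspensionOddIso X i n hi).hom ≫ (-(P n).map (S.map X.f)) ≫ (κ n).hom.app X.N ≫
        (suspensionEvenIso X j (n + 1) hj).inv :=
  (complexFunctor_d_odd _ i j n hi hj).trans (by
    rw [← Functor.map_neg]; rfl)

/-- The complex of the suspension of a factorization is isomorphic to the shifted complex. -/
def complexSuspensionIso (X : Fact z) :
    (complexFunctor z P κ hP).obj ((Fact.suspension z).obj X) ≅
      ((complexFunctor z P κ hP).obj X)⟦(1 : ℤ)⟧ :=
  HomologicalComplex.Hom.isoOfComponents
    (complexSuspensionXIso X)
    (by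
      intro i j hij
      have hij : i + 1 = j := hij
      rcases even_or_odd' i with ⟨n, h⟩ | ⟨n, h⟩
      · rw [complexSuspensionXIso_even X i n h, complexSuspensionXIso_odd X j n (by lia),
          suspension_d_even X i j n h (by lia), shift_d_even X i j n h (by lia)]
        simp [-CochainComplex.shiftFunctor_obj_X']
      · rw [complexSuspensionXIso_odd X i n h, complexSuspensionXIso_even X j (n + 1) (by lia),
          suspension_d_odd X i j n h (by lia), shift_d_odd X i j n h (by lia)]
        -- Both differentials carry the same sign, so the square reduces to naturality of `κ n` at
        -- `X.f`.
        simp [-CochainComplex.shiftFunctor_obj_X', reassoc_of% (twist_hom_naturality κ n X.f)])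

lemma complexSuspensionIso_hom_even (X : Fact z) (i n : ℤ) (h : i = 2 * n) :
    (complexSuspensionIso (P := P) (κ := κ) (hP := hP) X).hom.f i =
      (suspensionEvenIso X i n h).hom ≫ (shiftEvenIso X i n h).inv :=
  congrArg Iso.hom (complexSuspensionXIso_even X i n h)

lemma complexSuspensionIso_hom_odd (X : Fact z) (i n : ℤ) (h : i = 2 * n + 1) :
    (complexSuspensionIso (P := P) (κ := κ) (hP := hP) X).hom.f i =
      (suspensionOddIso X i n h).hom ≫ (κ n).hom.app X.M ≫ (shiftOddIso X i n h).inv :=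
  congrArg Iso.hom (complexSuspensionXIso_odd X i n h)

lemma complexSuspensionIso_naturality {X Y : Fact z} (θ : X ⟶ Y) :
    (complexFunctor z P κ hP).map ((Fact.suspension z).map θ) ≫ (complexSuspensionIso Y).hom =
      (complexSuspensionIso X).hom ≫ ((complexFunctor z P κ hP).map θ)⟦(1 : ℤ)⟧' := by
  ext i
  rw [HomologicalComplex.comp_f, HomologicalComplex.comp_f]
  rcases even_or_odd' i with ⟨n, h⟩ | ⟨n, h⟩
  · rw [complexSuspensionIso_hom_even X i n h, complexSuspensionIso_hom_even Y i n h,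
      suspension_map_even θ i n h, shift_map_even θ i n h]
    simp [-CochainComplex.shiftFunctor_obj_X']
  · rw [complexSuspensionIso_hom_odd X i n h, complexSuspensionIso_hom_odd Y i n h,
      suspension_map_odd θ i n h, shift_map_odd θ i n h]
    simp [-CochainComplex.shiftFunctor_obj_X', reassoc_of% (twist_hom_naturality κ n θ.ψ)]

end ComplexFunctor
-- The mapping cone of complexes and the complex of a mapping cone
section Cone

variable {D : Type u} [Category.{v} D] {C : Type u'} [Category.{v'} C] {S : C ⥤ C}
  {z : CentralElement S} [Preadditive D] [Preadditive C] [S.Additive]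
  [HasBinaryBiproducts C]
  {P : ℤ → C ⥤ D} {κ : ∀ n, S ⋙ P n ≅ P (n + 1)}
  {hP : ∀ n M, (P n).map (z.η.app M) = 0}

open CochainComplex CochainComplex.HomComplex

/-- The term of even degree of the complex of a mapping cone. -/
noncomputable def coneEvenIso {X Y : Fact z} (θ : X ⟶ Y) (i n : ℤ) (h : i = 2 * n) :
    ((complexFunctor z P κ hP).obj (Fact.cone θ)).X i ≅ (P n).obj (X.N ⊞ Y.M) :=
  evenIso (Fact.cone θ) i n h

/-- The term of odd degree of the complex of a mapping cone. -/
noncomputable def coneOddIso {X Y : Fact z} (θ : X ⟶ Y) (i n : ℤ) (h : i = 2 * n + 1) :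
    ((complexFunctor z P κ hP).obj (Fact.cone θ)).X i ≅ (P n).obj (S.obj X.M ⊞ Y.N) :=
  oddIso (Fact.cone θ) i n h

/-- The first map of a mapping cone. -/
noncomputable def coneF {X Y : Fact z} (θ : X ⟶ Y) : X.N ⊞ Y.M ⟶ S.obj X.M ⊞ Y.N :=
  (Fact.cone θ).f

/-- The second map of a mapping cone. -/
noncomputable def coneG {X Y : Fact z} (θ : X ⟶ Y) : S.obj X.M ⊞ Y.N ⟶ S.obj (X.N ⊞ Y.M) :=
  (Fact.cone θ).g

lemma inl_coneF {X Y : Fact z} (θ : X ⟶ Y) :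
    biprod.inl ≫ coneF θ = -(X.g ≫ biprod.inl) + θ.φ ≫ biprod.inr := by
  refine (biprod.inl_desc _ _).trans ?_
  apply biprod.hom_ext <;> simp

/-- The right-hand side is a single map in the image of `S`, so that `twist_hom_naturality` applies
to it. The other column of the matrix is already contained in `coneι` being a morphism. -/
lemma inl_coneG {X Y : Fact z} (θ : X ⟶ Y) :
    biprod.inl ≫ coneG θ = S.map (-(X.f ≫ biprod.inl) + θ.ψ ≫ biprod.inr) := by
  refine (biprod.inl_desc _ _).trans ?_
  simp

lemma cone_d_even {X Y : Fact z} (θ : X ⟶ Y) (i j n : ℤ) (hi : i = 2 * n)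
    (hj : j = 2 * n + 1) :
    ((complexFunctor z P κ hP).obj (Fact.cone θ)).d i j =
      (coneEvenIso θ i n hi).hom ≫ (P n).map (coneF θ) ≫ (coneOddIso θ j n hj).inv :=
  complexFunctor_d_even _ i j n hi hj

lemma cone_d_odd {X Y : Fact z} (θ : X ⟶ Y) (i j n : ℤ) (hi : i = 2 * n + 1)
    (hj : j = 2 * (n + 1)) :
    ((complexFunctor z P κ hP).obj (Fact.cone θ)).d i j =
      (coneOddIso θ i n hi).hom ≫ (P n).map (coneG θ) ≫
        (κ n).hom.app (X.N ⊞ Y.M) ≫ (coneEvenIso θ j (n + 1) hj).inv :=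
  complexFunctor_d_odd _ i j n hi hj

lemma coneι_map_even {X Y : Fact z} (θ : X ⟶ Y) (i n : ℤ) (hi : i = 2 * n) :
    ((complexFunctor z P κ hP).map (Fact.coneι θ)).f i =
      (evenIso Y i n hi).hom ≫ (P n).map biprod.inr ≫ (coneEvenIso θ i n hi).inv :=
  complexFunctor_map_even _ i n hi

lemma coneι_map_odd {X Y : Fact z} (θ : X ⟶ Y) (i n : ℤ) (hi : i = 2 * n + 1) :
    ((complexFunctor z P κ hP).map (Fact.coneι θ)).f i =
      (oddIso Y i n hi).hom ≫ (P n).map biprod.inr ≫ (coneOddIso θ i n hi).inv :=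
  complexFunctor_map_odd _ i n hi

lemma coneπ_map_even {X Y : Fact z} (θ : X ⟶ Y) (i n : ℤ) (hi : i = 2 * n) :
    ((complexFunctor z P κ hP).map (Fact.coneπ θ)).f i =
      (coneEvenIso θ i n hi).hom ≫ (P n).map biprod.fst ≫ (suspensionEvenIso X i n hi).inv :=
  complexFunctor_map_even _ i n hi

lemma coneπ_map_odd {X Y : Fact z} (θ : X ⟶ Y) (i n : ℤ) (hi : i = 2 * n + 1) :
    ((complexFunctor z P κ hP).map (Fact.coneπ θ)).f i =
      (coneOddIso θ i n hi).hom ≫ (P n).map biprod.fst ≫ (suspensionOddIso X i n hi).inv :=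
  complexFunctor_map_odd _ i n hi

/-- The component in target degree `j` of the inclusion of the source, as a cochain of degree
`-1`, into the complex of the mapping cone. -/
noncomputable def coneInl {X Y : Fact z} (θ : X ⟶ Y) (j i : ℤ) (h : i + -1 = j) :
    ((complexFunctor z P κ hP).obj X).X i ⟶ ((complexFunctor z P κ hP).obj (Fact.cone θ)).X j :=
  parityRec (F := fun j => ∀ i, i + -1 = j → (((complexFunctor z P κ hP).obj X).X i ⟶
      ((complexFunctor z P κ hP).obj (Fact.cone θ)).X j))
    (fun j n hj i hi => (oddIso X i n (by lia)).hom ≫ (P n).map biprod.inl ≫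
      (coneEvenIso θ j n hj).inv)
    (fun j n hj i hi => (evenIso X i (n + 1) (by lia)).hom ≫ (κ n).inv.app X.M ≫
      (P n).map biprod.inl ≫ (coneOddIso θ j n hj).inv) j i h

lemma coneInl_even {X Y : Fact z} (θ : X ⟶ Y) (j i n : ℤ) (h : i + -1 = j) (hj : j = 2 * n)
    (hi : i = 2 * n + 1) :
    coneInl (P := P) (κ := κ) (hP := hP) θ j i h =
      (oddIso X i n hi).hom ≫ (P n).map biprod.inl ≫ (coneEvenIso θ j n hj).inv := by
  rw [coneInl, parityRec_even _ _ hj]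

lemma coneInl_odd {X Y : Fact z} (θ : X ⟶ Y) (j i n : ℤ) (h : i + -1 = j)
    (hj : j = 2 * n + 1) (hi : i = 2 * (n + 1)) :
    coneInl (P := P) (κ := κ) (hP := hP) θ j i h =
      (evenIso X i (n + 1) hi).hom ≫ (κ n).inv.app X.M ≫ (P n).map biprod.inl ≫
        (coneOddIso θ j n hj).inv := by
  rw [coneInl, parityRec_odd _ _ hj]

/-- This and the next four lemmas say that an additive functor preserves the biproduct relations.
They allow computing with `P n` of a biproduct without forming a biproduct of the images. -/
lemma map_biprod_total (F : C ⥤ D) [F.Additive] (M N : C) :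
    F.map (biprod.fst : M ⊞ N ⟶ M) ≫ F.map biprod.inl + F.map biprod.snd ≫ F.map biprod.inr =
      𝟙 (F.obj (M ⊞ N)) := by
  rw [← F.map_comp, ← F.map_comp, ← F.map_add, biprod.total, F.map_id]

lemma map_inl_fst (F : C ⥤ D) [F.Additive] (M N : C) :
    F.map (biprod.inl : M ⟶ M ⊞ N) ≫ F.map biprod.fst = 𝟙 _ := by
  rw [← F.map_comp, biprod.inl_fst, F.map_id]

lemma map_inl_snd (F : C ⥤ D) [F.Additive] (M N : C) :
    F.map (biprod.inl : M ⟶ M ⊞ N) ≫ F.map biprod.snd = 0 := by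
  rw [← F.map_comp, biprod.inl_snd, F.map_zero]

lemma map_inr_fst (F : C ⥤ D) [F.Additive] (M N : C) :
    F.map (biprod.inr : N ⟶ M ⊞ N) ≫ F.map biprod.fst = 0 := by
  rw [← F.map_comp, biprod.inr_fst, F.map_zero]

lemma map_inr_snd (F : C ⥤ D) [F.Additive] (M N : C) :
    F.map (biprod.inr : N ⟶ M ⊞ N) ≫ F.map biprod.snd = 𝟙 _ := by
  rw [← F.map_comp, biprod.inr_snd, F.map_id]

variable [∀ n, (P n).Additive]

/-- The cocycle condition needed to map out of the mapping cone. The first column of each cone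
matrix has entries `-g, φ` or `-f, ψ`: the negative entry cancels the term with the differential of
the source, and the other entry is `θ` followed by the inclusion. -/
lemma coneInl_d {X Y : Fact z} (θ : X ⟶ Y) (i j k : ℤ) (hij : i + -1 = j) (hik : k + -1 = i) :
    coneInl (P := P) (κ := κ) (hP := hP) θ j i hij ≫
        ((complexFunctor z P κ hP).obj (Fact.cone θ)).d j i +
      ((complexFunctor z P κ hP).obj X).d i k ≫ coneInl θ i k hik =
    ((complexFunctor z P κ hP).map θ).f i ≫ ((complexFunctor z P κ hP).map (Fact.coneι θ)).f i := by
  rcases even_or_odd' j with ⟨n, hj⟩ | ⟨n, hj⟩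
  · have e : (P n).map biprod.inl ≫ (P n).map (coneF θ) =
        -(P n).map X.g ≫ (P n).map biprod.inl + (P n).map θ.φ ≫ (P n).map biprod.inr := by
      rw [← Functor.map_comp, inl_coneF]
      simp
    rw [coneInl_even θ j i n hij hj (by lia), coneInl_odd θ i k n hik (by lia) (by lia),
      cone_d_even θ j i n hj (by lia), complexFunctor_d_odd X i k n (by lia) (by lia),
      complexFunctor_map_odd θ i n (by lia), coneι_map_odd θ i n (by lia)]
    simp only [Category.assoc, Iso.inv_hom_id_assoc, reassoc_of% e, Iso.hom_inv_id_app_assoc,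
      Preadditive.add_comp, Preadditive.neg_comp, Preadditive.comp_add, Preadditive.comp_neg]
    abel
  · have e : (P n).map biprod.inl ≫ (P n).map (coneG θ) ≫ (κ n).hom.app (X.N ⊞ Y.M) =
        (κ n).hom.app X.M ≫ (-(P (n + 1)).map X.f ≫ (P (n + 1)).map biprod.inl +
          (P (n + 1)).map θ.ψ ≫ (P (n + 1)).map biprod.inr) := by
      rw [← Category.assoc, ← Functor.map_comp, inl_coneG, twist_hom_naturality]
      simp
    rw [coneInl_odd θ j i n hij hj (by lia), coneInl_even θ i k (n + 1) hik (by lia) (by lia),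
      cone_d_odd θ j i n hj (by lia), complexFunctor_d_even X i k (n + 1) (by lia) (by lia),
      complexFunctor_map_even θ i (n + 1) (by lia), coneι_map_even θ i (n + 1) (by lia)]
    simp only [Category.assoc, Iso.inv_hom_id_assoc, reassoc_of% e,
      Preadditive.add_comp, Preadditive.neg_comp, Preadditive.comp_add, Preadditive.comp_neg,
      Iso.inv_hom_id_app_assoc]
    abel

variable [HasBinaryBiproducts D]

/-- The comparison map from the mapping cone of complexes to the complex of the mapping cone. -/
noncomputable def coneComparison {X Y : Fact z} (θ : X ⟶ Y) :
    mappingCone ((complexFunctor z P κ hP).map θ) ⟶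
      (complexFunctor z P κ hP).obj (Fact.cone θ) :=
  mappingCone.desc _ (Cochain.mk fun i j h => coneInl θ j i h)
    ((complexFunctor z P κ hP).map (Fact.coneι θ)) (by
      ext i
      -- The coboundary of a cochain of degree `-1` has degree `0`, so the second summand gets the
      -- sign `(-1) ^ 0 = 1`.
      rw [δ_v (-1) 0 (by simp) _ i i (by simp) (i - 1) (i + 1) rfl rfl, Cochain.mk_v, Cochain.mk_v]
      simpa using coneInl_d θ i (i - 1) (i + 1) (by lia) (by lia))

lemma inl_coneComparison {X Y : Fact z} (θ : X ⟶ Y) (i j : ℤ) (h : i + -1 = j) :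
    (mappingCone.inl ((complexFunctor z P κ hP).map θ)).v i j h ≫ (coneComparison θ).f j =
      coneInl θ j i h :=
  mappingCone.inl_v_desc_f ..

lemma inr_coneComparison {X Y : Fact z} (θ : X ⟶ Y) :
    mappingCone.inr ((complexFunctor z P κ hP).map θ) ≫ coneComparison θ =
      (complexFunctor z P κ hP).map (Fact.coneι θ) :=
  mappingCone.inr_desc ..

lemma inr_f_coneComparison {X Y : Fact z} (θ : X ⟶ Y) (j : ℤ) :
    (mappingCone.inr ((complexFunctor z P κ hP).map θ)).f j ≫ (coneComparison θ).f j =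
      ((complexFunctor z P κ hP).map (Fact.coneι θ)).f j :=
  mappingCone.inr_f_desc_f ..

/-- In each degree both sides are direct sums of the same two terms, up to `κ n` on the first
summand in odd degree. The inverse projects inside `P n` of the biproduct and then includes by `inl`
and `inr`. -/
instance {X Y : Fact z} (θ : X ⟶ Y) (j : ℤ) :
    IsIso ((coneComparison (P := P) (κ := κ) (hP := hP) θ).f j) := by
  rcases even_or_odd' j with ⟨n, hj⟩ | ⟨n, hj⟩
  · refine ⟨(coneEvenIso θ j n hj).hom ≫
      ((P n).map biprod.fst ≫ (oddIso X (j + 1) n (by lia)).inv ≫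
          (mappingCone.inl ((complexFunctor z P κ hP).map θ)).v (j + 1) j (by lia) +
        (P n).map biprod.snd ≫ (evenIso Y j n hj).inv ≫
          (mappingCone.inr ((complexFunctor z P κ hP).map θ)).f j), ?_, ?_⟩
    · apply mappingCone.ext_from _ (j + 1) j rfl
      · rw [reassoc_of% (inl_coneComparison θ (j + 1) j (by lia)),
          coneInl_even θ j (j + 1) n (by lia) hj (by lia)]
        simp [reassoc_of% (map_inl_fst (P n)), reassoc_of% (map_inl_snd (P n))]
      · rw [reassoc_of% (inr_f_coneComparison θ j), coneι_map_even θ j n hj]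
        simp [reassoc_of% (map_inr_fst (P n)), reassoc_of% (map_inr_snd (P n))]
    · simp only [Category.assoc, Preadditive.add_comp, inl_coneComparison, inr_f_coneComparison,
        coneInl_even θ j (j + 1) n (by lia) hj (by lia), coneι_map_even θ j n hj,
        Iso.inv_hom_id_assoc]
      rw [← Category.assoc ((P n).map biprod.fst), ← Category.assoc ((P n).map biprod.snd),
        ← Preadditive.add_comp, map_biprod_total, Category.id_comp, Iso.hom_inv_id]
  · refine ⟨(coneOddIso θ j n hj).hom ≫
      ((P n).map biprod.fst ≫ (κ n).hom.app X.M ≫ (evenIso X (j + 1) (n + 1) (by lia)).inv ≫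
          (mappingCone.inl ((complexFunctor z P κ hP).map θ)).v (j + 1) j (by lia) +
        (P n).map biprod.snd ≫ (oddIso Y j n hj).inv ≫
          (mappingCone.inr ((complexFunctor z P κ hP).map θ)).f j), ?_, ?_⟩
    · apply mappingCone.ext_from _ (j + 1) j rfl
      · rw [reassoc_of% (inl_coneComparison θ (j + 1) j (by lia)),
          coneInl_odd θ j (j + 1) n (by lia) hj (by lia)]
        simp [reassoc_of% (map_inl_fst (P n)), reassoc_of% (map_inl_snd (P n))]
      · rw [reassoc_of% (inr_f_coneComparison θ j), coneι_map_odd θ j n hj]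
        simp [reassoc_of% (map_inr_fst (P n)), reassoc_of% (map_inr_snd (P n))]
    · simp only [Category.assoc, Preadditive.add_comp, inl_coneComparison, inr_f_coneComparison,
        coneInl_odd θ j (j + 1) n (by lia) hj (by lia), coneι_map_odd θ j n hj,
        Iso.inv_hom_id_assoc, Iso.hom_inv_id_app_assoc]
      rw [← Category.assoc ((P n).map biprod.fst), ← Category.assoc ((P n).map biprod.snd),
        ← Preadditive.add_comp, map_biprod_total, Category.id_comp, Iso.hom_inv_id]

instance {X Y : Fact z} (θ : X ⟶ Y) :
    IsIso (coneComparison (P := P) (κ := κ) (hP := hP) θ) :=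
  HomologicalComplex.Hom.isIso_of_components _

/-- The third morphism of the standard triangle of a morphism of complexes. -/
noncomputable def connecting {K L : CochainComplex D ℤ} (φ : K ⟶ L) :
    mappingCone φ ⟶ K⟦(1 : ℤ)⟧ :=
  (mappingCone.triangle φ).mor₃

/-- The source of the only sign discrepancy: on the shifted copy of `K` the connecting morphism is
minus the identity, where `(K⟦1⟧).X j` is `K.X (j + 1)` by definition. -/
lemma inl_connecting {K L : CochainComplex D ℤ} (φ : K ⟶ L) (j : ℤ) :
    (mappingCone.inl φ).v (j + 1) j (by lia) ≫ (connecting φ).f j =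
      -(show K.X (j + 1) ⟶ (K⟦(1 : ℤ)⟧).X j from 𝟙 (K.X (j + 1))) :=
  mappingCone.inl_v_triangle_mor₃_f φ (j + 1) j (by lia)

lemma inr_connecting {K L : CochainComplex D ℤ} (φ : K ⟶ L) (j : ℤ) :
    (mappingCone.inr φ).f j ≫ (connecting φ).f j = 0 :=
  mappingCone.inr_f_triangle_mor₃_f φ j

/-- The projection of the mapping cone of complexes corresponds to the projection of the mapping
cone of factorizations, up to a sign. -/
lemma coneComparison_π {X Y : Fact z} (θ : X ⟶ Y) :
    coneComparison (P := P) (κ := κ) (hP := hP) θ ≫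
        (complexFunctor z P κ hP).map (Fact.coneπ θ) ≫ (complexSuspensionIso X).hom =
      -connecting ((complexFunctor z P κ hP).map θ) := by
  ext j
  rw [HomologicalComplex.neg_f_apply, HomologicalComplex.comp_f, HomologicalComplex.comp_f]
  -- It suffices to compare on the two summands. On the first one both sides are the identity, and
  -- on the second one both vanish.
  apply mappingCone.ext_from _ (j + 1) j rfl
  · rw [Preadditive.comp_neg, inl_connecting, neg_neg,
      reassoc_of% (inl_coneComparison (P := P) (κ := κ) (hP := hP) θ (j + 1) j (by lia))]
    rcases even_or_odd' j with ⟨n, hj⟩ | ⟨n, hj⟩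
    · rw [coneInl_even θ j (j + 1) n (by lia) hj (by lia), coneπ_map_even θ j n hj,
        complexSuspensionIso_hom_even X j n hj]
      simp only [Category.assoc, Iso.inv_hom_id_assoc, reassoc_of% (map_inl_fst (P n))]
      -- By definition `shiftEvenIso` in degree `j` is `oddIso` in degree `j + 1`.
      exact (oddIso X (j + 1) n (by lia)).hom_inv_id
    · rw [coneInl_odd θ j (j + 1) n (by lia) hj (by lia), coneπ_map_odd θ j n hj,
        complexSuspensionIso_hom_odd X j n hj]
      simp only [Category.assoc, Iso.inv_hom_id_assoc, reassoc_of% (map_inl_fst (P n)),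
        Iso.inv_hom_id_app_assoc]
      exact (evenIso X (j + 1) (n + 1) (by lia)).hom_inv_id
  · rw [Preadditive.comp_neg, inr_connecting, neg_zero,
      reassoc_of% (inr_f_coneComparison (P := P) (κ := κ) (hP := hP) θ j)]
    rcases even_or_odd' j with ⟨n, hj⟩ | ⟨n, hj⟩
    · rw [coneι_map_even θ j n hj, coneπ_map_even θ j n hj]
      simp only [Category.assoc, Iso.inv_hom_id_assoc, reassoc_of% (map_inr_fst (P n)),
        zero_comp, comp_zero]
    · rw [coneι_map_odd θ j n hj, coneπ_map_odd θ j n hj]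
      simp only [Category.assoc, Iso.inv_hom_id_assoc, reassoc_of% (map_inr_fst (P n)),
        zero_comp, comp_zero]

end Cone

/-! ### Transport of triangles along functors and isomorphisms -/

section Triangles

variable {T : Type u} [Category.{v} T] {E : T ⥤ T}
  {T' : Type u'} [Category.{v'} T'] {E' : T' ⥤ T'}

/-- The first two squares are functoriality; the third also needs naturality of `ξ` at the
isomorphism of the first objects. -/
lemma Tri.Isomorphic.map (F : T ⥤ T') (ξ : E ⋙ F ≅ F ⋙ E') {X Y : Tri E}
    (h : X.Isomorphic Y) : (X.map F ξ).Isomorphic (Y.map F ξ) := by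
  obtain ⟨e₁, e₂, e₃, h₁, h₂, h₃⟩ := h
  refine ⟨F.mapIso e₁, F.mapIso e₂, F.mapIso e₃, ?_, ?_, ?_⟩
  · change F.map X.mor₁ ≫ F.map e₂.hom = F.map e₁.hom ≫ F.map Y.mor₁
    rw [← F.map_comp, h₁, F.map_comp]
  · change F.map X.mor₂ ≫ F.map e₃.hom = F.map e₂.hom ≫ F.map Y.mor₂
    rw [← F.map_comp, h₂, F.map_comp]
  · change (F.map X.mor₃ ≫ ξ.hom.app X.obj₁) ≫ E'.map (F.map e₁.hom) =
      F.map e₃.hom ≫ F.map Y.mor₃ ≫ ξ.hom.app Y.obj₁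
    have hξ : F.map (E.map e₁.hom) ≫ ξ.hom.app Y.obj₁ =
        ξ.hom.app X.obj₁ ≫ E'.map (F.map e₁.hom) := ξ.hom.naturality e₁.hom
    rw [Category.assoc, ← hξ, ← F.map_comp_assoc, h₃, F.map_comp, Category.assoc]

lemma KCat.distinguished_of_isomorphic {D : Type u} [Category.{v} D] [Preadditive D]
    [HasZeroObject D] [HasBinaryBiproducts D] {X Y : Tri (shiftFunctor (KCat D) (1 : ℤ))}
    (h : X.Isomorphic Y) (hY : Y ∈ KCat.distinguished D) : X ∈ KCat.distinguished D := by
  obtain ⟨e₁, e₂, e₃, h₁, h₂, h₃⟩ := h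
  exact Pretriangulated.isomorphic_distinguished (C := KCat D) _ hY _
    (Pretriangulated.Triangle.isoMk (Pretriangulated.Triangle.mk X.mor₁ X.mor₂ X.mor₃)
      (Pretriangulated.Triangle.mk Y.mor₁ Y.mor₂ Y.mor₃) e₁ e₂ e₃ h₁ h₂ h₃)

/-- The standard triangle of a morphism of complexes, in the homotopy category. -/
noncomputable def KCat.standardTriangle {D : Type u} [Category.{v} D] [Preadditive D]
    [HasBinaryBiproducts D] {K L : CochainComplex D ℤ} (φ : K ⟶ L) :
    Tri (shiftFunctor (KCat D) (1 : ℤ)) where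
  obj₁ := (HomotopyCategory.quotient D (ComplexShape.up ℤ)).obj K
  obj₂ := (HomotopyCategory.quotient D (ComplexShape.up ℤ)).obj L
  obj₃ := (HomotopyCategory.quotient D (ComplexShape.up ℤ)).obj (CochainComplex.mappingCone φ)
  mor₁ := (HomotopyCategory.quotient D (ComplexShape.up ℤ)).map φ
  mor₂ := (HomotopyCategory.quotient D (ComplexShape.up ℤ)).map (CochainComplex.mappingCone.inr φ)
  mor₃ := (HomotopyCategory.quotient D (ComplexShape.up ℤ)).map (connecting φ) ≫
    ((HomotopyCategory.quotient D (ComplexShape.up ℤ)).commShiftIso (1 : ℤ)).hom.app K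

lemma KCat.standardTriangle_distinguished {D : Type u} [Category.{v} D] [Preadditive D]
    [HasZeroObject D] [HasBinaryBiproducts D] {K L : CochainComplex D ℤ} (φ : K ⟶ L) :
    KCat.standardTriangle φ ∈ KCat.distinguished D :=
  HomotopyCategory.mappingCone_triangleh_distinguished φ

end Triangles

/-! ### The induced triangle functor on homotopy categories -/

section HFact

variable {D : Type u} [Category.{v} D] {C : Type u'} [Category.{v'} C] {S : C ⥤ C}
  (z : CentralElement S) [Preadditive D] [Preadditive C] [S.Additive]
  (P : ℤ → C ⥤ D) [∀ n, (P n).Additive] (κ : ∀ n, S ⋙ P n ≅ P (n + 1))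
  (hP : ∀ n M, (P n).map (z.η.app M) = 0)

/-- The functor on homotopy categories induced by `complexFunctor`. -/
def hComplexFunctor : HFact z ⥤ KCat D :=
  CategoryTheory.Quotient.lift _
    (complexFunctor z P κ hP ⋙ HomotopyCategory.quotient D (ComplexShape.up ℤ))
    (fun _ _ _ _ h => complexFunctor_homotopic _ _ h)

/-- The quotient functor is full, so additivity can be checked on representatives. -/
instance : (hComplexFunctor z P κ hP).Additive where
  map_add {X Y a b} := by
    obtain ⟨a, rfl⟩ := (HFact.quotient z).map_surjective a
    obtain ⟨b, rfl⟩ := (HFact.quotient z).map_surjective b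
    exact (complexFunctor z P κ hP ⋙ HomotopyCategory.quotient D (ComplexShape.up ℤ)).map_add

/-- The component of the isomorphism between the image of a suspension and the shift. The sign
accounts for the one in the third morphism of the standard triangles of `K(D)`. -/
noncomputable def hComplexSuspensionIso (X : Fact z) :
    (HomotopyCategory.quotient D (ComplexShape.up ℤ)).obj
        ((complexFunctor z P κ hP).obj ((Fact.suspension z).obj X)) ≅
      ((HomotopyCategory.quotient D (ComplexShape.up ℤ)).obj
        ((complexFunctor z P κ hP).obj X))⟦(1 : ℤ)⟧ :=
  -((HomotopyCategory.quotient D (ComplexShape.up ℤ)).mapIso (complexSuspensionIso X) ≪≫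
    ((HomotopyCategory.quotient D (ComplexShape.up ℤ)).commShiftIso (1 : ℤ)).app
      ((complexFunctor z P κ hP).obj X))

lemma hComplexSuspensionIso_hom (X : Fact z) :
    (hComplexSuspensionIso z P κ hP X).hom =
      -((HomotopyCategory.quotient D (ComplexShape.up ℤ)).map (complexSuspensionIso X).hom ≫
        ((HomotopyCategory.quotient D (ComplexShape.up ℤ)).commShiftIso (1 : ℤ)).hom.app
          ((complexFunctor z P κ hP).obj X)) :=
  rfl

/-- The sign occurs on both sides and cancels; what remains is naturality of `complexSuspensionIso`
and of the shift isomorphism of the quotient functor. -/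
lemma hComplexSuspensionIso_naturality {X Y : Fact z} (θ : X ⟶ Y) :
    (HomotopyCategory.quotient D (ComplexShape.up ℤ)).map
        ((complexFunctor z P κ hP).map ((Fact.suspension z).map θ)) ≫
        (hComplexSuspensionIso z P κ hP Y).hom =
      (hComplexSuspensionIso z P κ hP X).hom ≫
        ((HomotopyCategory.quotient D (ComplexShape.up ℤ)).map
          ((complexFunctor z P κ hP).map θ))⟦(1 : ℤ)⟧' := by
  have h := ((HomotopyCategory.quotient D (ComplexShape.up ℤ)).commShiftIso (1 : ℤ)).hom.naturality
    ((complexFunctor z P κ hP).map θ)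
  dsimp only [Functor.comp_map, Functor.comp_obj] at h
  rw [hComplexSuspensionIso_hom, hComplexSuspensionIso_hom, Preadditive.comp_neg,
    Preadditive.neg_comp, Category.assoc, ← h, ← Functor.map_comp_assoc, ← Functor.map_comp_assoc,
    complexSuspensionIso_naturality]

/-- The compatibility of `hComplexFunctor` with the suspensions. -/
noncomputable def hComplexFunctorSuspensionIso :
    HFact.suspension z ⋙ hComplexFunctor z P κ hP ≅
      hComplexFunctor z P κ hP ⋙ shiftFunctor (KCat D) (1 : ℤ) :=
  CategoryTheory.Quotient.natIsoLift _
    (NatIso.ofComponents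
      (F := HFact.quotient z ⋙ HFact.suspension z ⋙ hComplexFunctor z P κ hP)
      (G := HFact.quotient z ⋙ hComplexFunctor z P κ hP ⋙ shiftFunctor (KCat D) (1 : ℤ))
      (fun X => hComplexSuspensionIso z P κ hP X)
      (fun θ => hComplexSuspensionIso_naturality z P κ hP θ))

variable [HasBinaryBiproducts C] [HasBinaryBiproducts D]

/-- The isomorphism is the identity on the first two objects and the inverse of `coneComparison` on
the cones. The third square commutes on the nose because the sign in `hComplexSuspensionIso` meets
the one in `coneComparison_π`. -/
lemma map_standardTriangle_isomorphic {X Y : Fact z} (θ : X ⟶ Y) :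
    ((HFact.standardTriangle θ).map (hComplexFunctor z P κ hP)
      (hComplexFunctorSuspensionIso z P κ hP)).Isomorphic
      (KCat.standardTriangle ((complexFunctor z P κ hP).map θ)) := by
  let Q := HomotopyCategory.quotient D (ComplexShape.up ℤ)
  let e := Q.mapIso (asIso (coneComparison (P := P) (κ := κ) (hP := hP) θ))
  have h₂ : Q.map ((complexFunctor z P κ hP).map (Fact.coneι θ)) ≫ e.inv =
      Q.map (CochainComplex.mappingCone.inr _) := by
    rw [Iso.comp_inv_eq]
    exact (congrArg Q.map (inr_coneComparison θ)).symm.trans (Q.map_comp _ _)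
  have h₃ : Q.map ((complexFunctor z P κ hP).map (Fact.coneπ θ)) ≫
      (hComplexSuspensionIso z P κ hP X).hom =
      e.inv ≫ Q.map (connecting _) ≫ (Q.commShiftIso (1 : ℤ)).hom.app _ := by
    rw [Iso.eq_inv_comp]
    have h := coneComparison_π (P := P) (κ := κ) (hP := hP) θ
    rw [← neg_eq_iff_eq_neg] at h
    rw [hComplexSuspensionIso_hom, ← h, Functor.map_neg, Functor.map_comp, Functor.map_comp]
    simp only [Preadditive.comp_neg, Preadditive.neg_comp, Category.assoc]
    rfl
  refine ⟨Iso.refl _, Iso.refl _, e.symm, ?_, ?_, ?_⟩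
  · exact (Category.comp_id _).trans (Category.id_comp _).symm
  · exact h₂.trans (Category.id_comp _).symm
  -- The shift of the identity on the first object is removed before `h₃` is applied.
  · exact ((congrArg _ (CategoryTheory.Functor.map_id _ _)).trans (Category.comp_id _)).trans h₃

variable [HasZeroObject D]

lemma hComplexFunctor_isTriangleFunctor :
    IsTriangleFunctor (HFact.distinguished z) (KCat.distinguished D)
      (hComplexFunctor z P κ hP) := by
  refine ⟨inferInstance, hComplexFunctorSuspensionIso z P κ hP, ?_⟩
  rintro X ⟨Y₁, Y₂, θ, h⟩
  exact KCat.distinguished_of_isomorphic (h.map _ _)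
    (KCat.distinguished_of_isomorphic (map_standardTriangle_isomorphic z P κ hP θ)
      (KCat.standardTriangle_distinguished _))

end HFact

/-! ### Additivity of the twisted reductions modulo `w` -/

section Reduction

variable {B : Type u} [Ring B] (w : Subring.center B) (ν : B ≃+* B)

instance : (reduction.{v} w).Additive where
  map_add {M N f g} := by
    refine ModuleCat.hom_ext (LinearMap.ext fun x => ?_)
    obtain ⟨m, rfl⟩ := Submodule.Quotient.mk_surjective _ x
    rfl

instance (hν : ∀ b : B, ν (b * w) = b * w) (n : ℤ) :
    (twistedReduction.{v} w ν hν n).Additive :=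
  inferInstanceAs (reduction w ⋙ twist (redAut w ν hν ^ n)).Additive

instance (hν : ∀ b : B, ν (b * w) = b * w) (n : ℤ) :
    (twistedReductionFree.{v} w ν hν n).Additive where
  map_add := ObjectProperty.hom_ext _ (twistedReduction w ν hν n).map_add

end Reduction

end TwFact

theorem proposition3p1 {B : Type u} [Ring B] (w : Subring.center B) (ν : B ≃+* B)
    (hν : ∀ b : B, ν (b * w) = b * w) :
    (∃ T : TwFact.HFact (TwFact.etaMod.{v} w ν hν) ⥤
        TwFact.KCat (ModuleCat.{v} (TwFact.RedRing w)),
      TwFact.HFact.quotient (TwFact.etaMod w ν hν) ⋙ T =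
        TwFact.reductionComplex w ν hν ⋙ HomotopyCategory.quotient _ _ ∧
      TwFact.IsTriangleFunctor (TwFact.HFact.distinguished (TwFact.etaMod w ν hν))
        (TwFact.KCat.distinguished (ModuleCat.{v} (TwFact.RedRing w))) T) ∧
    (∃ T : TwFact.HFact (TwFact.etaFree.{v} w ν hν) ⥤
        TwFact.KCat (TwFact.FreeCat.{v} (TwFact.RedRing w)),
      TwFact.HFact.quotient (TwFact.etaFree w ν hν) ⋙ T =
        TwFact.reductionComplexFree w ν hν ⋙ HomotopyCategory.quotient _ _ ∧
      TwFact.IsTriangleFunctor (TwFact.HFact.distinguished (TwFact.etaFree w ν hν))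
        (TwFact.KCat.distinguished (TwFact.FreeCat.{v} (TwFact.RedRing w))) T) :=
  -- The functor is a lift to the quotient category, so its composite with the quotient functor is
  -- the original functor by definition. The same general result serves both categories.
  ⟨⟨TwFact.hComplexFunctor _ _ _ _, rfl, TwFact.hComplexFunctor_isTriangleFunctor _ _ _ _⟩,
    ⟨TwFact.hComplexFunctor _ _ _ _, rfl, TwFact.hComplexFunctor_isTriangleFunctor _ _ _ _⟩⟩
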